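/- Let $p,q\ge 0$ and $n=p+q$. Definitions. A sequence $H_j$ of closed subgroups of a topological group $G$ converges geometrically to a closed subgroup $L$ if every $g\in L$ is the limit of some sequence $h_j\in H_j$ and every accumulation point of every sequence $h_j\in H_j$ lies in $L$. A subgroup $L$ is a conjugacy limit of $H$ in $G$ if there is a sequence $c_j\in G$ such that $c_jHc_j^{-1}$ converges geometrically to $L$. Let $\mathrm{O}(p,q)\subset \mathrm{GL}_n\mathbb{R}$ be the isometry group of the quadratic form $-x_1^2-\cdots-x_p^2+x_{p+1}^2+\cdots+x_{p+q}^2$. A partial flag of $\mathbb{R}^n$ is a chain of subspaces $\mathcal F:\ \mathbb{R}^n=V_0\supsetneq V_1\supsetneq\cdots\supsetneq V_m=\{0\}$, and a partial flag of quadratic forms $\boldsymbol\beta=(\beta_0,\dots,\beta_{m-1})$ on $\mathcal F$ is a collection of non-degenerate quadratic forms $\beta_i$, one on each quotient $V_i/V_{i+1}$. The signature of $\beta_i$ is $(p_i,q_i)$, where $p_i$ (respectively $q_i$) is the maximal dimension of a subspace of $V_i/V_{i+1}$ on which $\beta_i$ is negative (respectively positive) definite. Let $\mathrm{Isom}(\boldsymbol\beta,\mathcal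 F)\subset\mathrm{GL}_n\mathbb{R}$ be the group of linear transformations which preserve $\mathcal F$ and induce an isometry of each $\beta_i$. For a subgroup $H\subset\mathrm{GL}_n\mathbb{R}$ let $\mathrm{P}H$ be its image in $\mathrm{PGL}_n\mathbb{R}$. Theorem. Every conjugacy limit of $\mathrm{O}(p,q)$ in $\mathrm{GL}_n\mathbb{R}$ (respectively of $\mathrm{PO}(p,q)$ in $\mathrm{PGL}_n\mathbb{R}$) is equal to $\mathrm{Isom}(\boldsymbol\beta,\mathcal F)$ (respectively $\mathrm{P}\,\mathrm{Isom}(\boldsymbol\beta,\mathcal F)$) for some partial flag of quadratic forms $\boldsymbol\beta$ on some partial flag $\mathcal F$ of $\mathbb{R}^n$. Further, for every partial flag of quadratic forms $\boldsymbol\beta$ on a partial flag $\mathcal F$ of $\mathbb{R}^n$, the group $\mathrm{Isom}(\boldsymbol\beta,\mathcal F)$ (respectively $\mathrm{P}\,\mathrm{Isom}(\boldsymbol\beta,\mathcal F)$) is a conjugacy limit of $\mathrm{O}(p,q)$ in $\mathrm{GL}_n\mathbb{R}$ (respectively of $\mathrm{PO}(p,q)$ in $\mathrm{PGL}_n\mathbb{R}$)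 if and only if, after exchanging $(p_i,q_i)$ with $(q_i,p_i)$ for some collection of indices $i$, $$p_0+\cdots+p_{m-1}=p\quad\text{and}\quad q_0+\cdots+q_{m-1}=q .$$ -/

import Mathlib

open Filter Topology Matrix MatrixGroups

noncomputable section

namespace GeometricLimits

/-- A sequence `H` of closed subgroups of a topological group converges geometrically to the closed
subgroup `L`: every element of `L` is the limit of a sequence `h n ∈ H n`, and every accumulation
point of every sequence `h n ∈ H n` lies in `L`. -/
def ConvergesGeometrically {G : Type*} [Group G] [TopologicalSpace G]
    (H : ℕ → Subgroup G) (L : Subgroup G) : Prop :=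
  (∀ n, IsClosed (H n : Set G)) ∧ IsClosed (L : Set G) ∧
  (∀ g ∈ L, ∃ h : ℕ → G, (∀ n, h n ∈ H n) ∧ Tendsto h atTop (𝓝 g)) ∧
  (∀ h : ℕ → G, (∀ n, h n ∈ H n) → ∀ g, MapClusterPt g atTop h → g ∈ L)

/-- `L` is a conjugacy limit of `H` in `G`: for some sequence `c n ∈ G`, the conjugates
`c n * H * (c n)⁻¹` converge geometrically to `L`. -/
def IsConjugacyLimit {G : Type*} [Group G] [TopologicalSpace G] (H L : Subgroup G) : Prop :=
  ∃ c : ℕ → G, ConvergesGeometrically (fun n => H.map (MulAut.conj (c n)).toMonoidHom) L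

/-- `PGL(n, ℝ) = GL(n, ℝ) / center`, with the quotient topology. -/
instance instTopologicalSpacePGL (n : ℕ) : TopologicalSpace PGL(n, ℝ) :=
  inferInstanceAs (TopologicalSpace (GL (Fin n) ℝ ⧸ Subgroup.center (GL (Fin n) ℝ)))

/-- The image `P(H)` in `PGL(n, ℝ)` of a subgroup `H` of `GL(n, ℝ)`. -/
def proj {n : ℕ} (H : Subgroup (GL (Fin n) ℝ)) : Subgroup PGL(n, ℝ) :=
  H.map Matrix.ProjGenLinGroup.mk

/-- The quadratic form `- x₁² - ⋯ - x_p² + x_{p+1}² + ⋯ + x_{p+q}²`, i.e. `-I_p ⊕ I_q`. -/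
def stdForm (p q : ℕ) : QuadraticForm ℝ (Fin (p + q) → ℝ) :=
  QuadraticMap.weightedSumSquares ℝ (fun i : Fin (p + q) => if (i : ℕ) < p then (-1 : ℝ) else 1)

/-- The indefinite orthogonal group `O(p,q)`, as a subgroup of `GL(p+q, ℝ)`. -/
def indefiniteO (p q : ℕ) : Subgroup (GL (Fin (p + q)) ℝ) where
  carrier := {g | ∀ x, stdForm p q ((g : Matrix _ _ ℝ) *ᵥ x) = stdForm p q x}
  mul_mem' {a b} ha hb x := by
    rw [Units.val_mul, ← Matrix.mulVec_mulVec, ha, hb]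
  one_mem' x := by simp
  inv_mem' {a} ha x := by
    rw [← ha, Matrix.mulVec_mulVec, ← Units.val_mul, mul_inv_cancel]
    simp

/-- A partial flag `ℝⁿ = V₀ ⊋ V₁ ⊋ ⋯ ⊋ V_m = 0`, with `m` successive quotients. -/
structure PartialFlag (n m : ℕ) where
  space : Fin (m + 1) → Submodule ℝ (Fin n → ℝ)
  strictAnti : StrictAnti space
  space_zero : space 0 = ⊤
  space_last : space (Fin.last m) = ⊥

namespace PartialFlag

variable {n m : ℕ} (F : PartialFlag n m)

/-- The successive quotient `V_i / V_{i+1}`. -/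
abbrev Quot (i : Fin m) : Type :=
  F.space i.castSucc ⧸ (F.space i.succ).submoduleOf (F.space i.castSucc)

/-- `g` preserves the flag: `g V_i = V_i` for all `i`. -/
def IsPreservedBy (g : GL (Fin n) ℝ) : Prop :=
  ∀ i, (F.space i).map (g : Matrix (Fin n) (Fin n) ℝ).mulVecLin = F.space i

variable {F}

theorem IsPreservedBy.mem {g : GL (Fin n) ℝ} (hg : F.IsPreservedBy g) (i : Fin (m + 1))
    (x : Fin n → ℝ) (hx : x ∈ F.space i) :
    (g : Matrix (Fin n) (Fin n) ℝ).mulVecLin x ∈ F.space i := by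
  rw [← hg i]
  exact Submodule.mem_map_of_mem hx

/-- The endomorphism of `V_i / V_{i+1}` induced by a `g` preserving the flag. -/
def IsPreservedBy.quotMap {g : GL (Fin n) ℝ} (hg : F.IsPreservedBy g) (i : Fin m) :
    F.Quot i →ₗ[ℝ] F.Quot i :=
  Submodule.mapQ _ _
    ((g : Matrix (Fin n) (Fin n) ℝ).mulVecLin.restrict (hg.mem i.castSucc))
    (fun x hx => hg.mem i.succ x hx)

theorem IsPreservedBy.one : F.IsPreservedBy 1 := by
  intro i
  simp

theorem IsPreservedBy.mul {a b : GL (Fin n) ℝ} (ha : F.IsPreservedBy a) (hb : F.IsPreservedBy b) :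
    F.IsPreservedBy (a * b) := by
  intro i
  rw [Units.val_mul, Matrix.mulVecLin_mul, Submodule.map_comp, hb, ha]

theorem IsPreservedBy.inv {a : GL (Fin n) ℝ} (ha : F.IsPreservedBy a) :
    F.IsPreservedBy a⁻¹ := by
  intro i
  conv_lhs => rw [← ha i]
  rw [← Submodule.map_comp, ← Matrix.mulVecLin_mul, ← Units.val_mul, inv_mul_cancel]
  simp

theorem IsPreservedBy.quotMap_one (h : F.IsPreservedBy 1) (i : Fin m) (x : F.Quot i) :
    h.quotMap i x = x := by
  induction x using Submodule.Quotient.induction_on with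
  | _ x =>
    refine congrArg Submodule.Quotient.mk (Subtype.ext ?_)
    simp [LinearMap.restrict_apply]

theorem IsPreservedBy.quotMap_mul {a b : GL (Fin n) ℝ} (ha : F.IsPreservedBy a)
    (hb : F.IsPreservedBy b) (hab : F.IsPreservedBy (a * b)) (i : Fin m) (x : F.Quot i) :
    hab.quotMap i x = ha.quotMap i (hb.quotMap i x) := by
  induction x using Submodule.Quotient.induction_on with
  | _ x =>
    refine congrArg Submodule.Quotient.mk (Subtype.ext ?_)
    simp [LinearMap.restrict_apply]

end PartialFlag

/-- A partial flag of quadratic forms on `F`: a nondegenerate quadratic form on each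
quotient `V_i / V_{i+1}`. -/
structure FlagOfForms {n m : ℕ} (F : PartialFlag n m) where
  form : ∀ i, QuadraticForm ℝ (F.Quot i)
  nondegenerate : ∀ i, (form i).Nondegenerate

namespace FlagOfForms

variable {n m : ℕ} {F : PartialFlag n m} (β : FlagOfForms F)

/-- `Isom(β, F)`: the linear transformations which preserve the flag `F` and induce an isometry
of each `β_i`. -/
def isom : Subgroup (GL (Fin n) ℝ) where
  carrier := {g | ∃ hg : F.IsPreservedBy g, ∀ i x, β.form i (hg.quotMap i x) = β.form i x}
  mul_mem' := by
    rintro a b ⟨ha, ha'⟩ ⟨hb, hb'⟩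
    refine ⟨ha.mul hb, fun i x => ?_⟩
    rw [ha.quotMap_mul hb, ha', hb']
  one_mem' := ⟨PartialFlag.IsPreservedBy.one, fun i x => by
    rw [PartialFlag.IsPreservedBy.quotMap_one]⟩
  inv_mem' := by
    rintro a ⟨ha, ha'⟩
    refine ⟨ha.inv, fun i x => ?_⟩
    rw [← ha', ← ha.quotMap_mul ha.inv (ha.mul ha.inv)]
    congr 1
    have h : ∀ (c : GL (Fin n) ℝ) (hc : F.IsPreservedBy c), c = 1 → hc.quotMap i x = x := by
      rintro c hc rfl
      exact hc.quotMap_one i x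
    exact h _ _ (mul_inv_cancel a)

/-- The signature `(p_i, q_i) = (n₋, n₊)` of `β_i`: the maximal dimensions of subspaces on which
`β_i` is negative, respectively positive, definite. -/
def signature (i : Fin m) : ℕ × ℕ := (sigNeg (β.form i), sigPos (β.form i))

/-- After exchanging `(p_i, q_i)` with `(q_i, p_i)` for some collection of indices `i` (those with
`e i = true`), the signatures of the `β_i` sum to `(p, q)`. -/
def SignaturesSumTo (p q : ℕ) : Prop :=
  ∃ e : Fin m → Bool,
    ∑ i, (if e i then (β.signature i).swap else β.signature i) = (p, q)

end FlagOfForms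

end GeometricLimits

end

/-!
# Conjugacy limits of the indefinite orthogonal groups

A conjugate `c O(p, q) c⁻¹` is the isometry group of the form `M = c⁻ᵀ J c⁻¹`, where `J` is the
standard form. By the spectral theorem `M` is diagonal in an orthonormal basis, and its eigenvalues
have the signs of `J`. Along a sequence `c_j`, the orthonormal bases converge, after passing to an
ultrafilter, and the eigenvalues fall into classes of comparable size; rescaling the eigenvectors by
a convergent sequence makes the absolute values of the eigenvalues equal within each class. This
reduces the computation of the limit to the diagonal forms `scaledForm w ε (s j)`, whose block sizes
`s j 0 ≫ s j 1 ≫ ⋯` separate as `j → ∞` (`exists_isBlockIsometry_iff_mem_limitSet`).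

For those forms the limit is the group of block triangular matrices whose diagonal blocks are
isometries of the blocks of `ε` (`mem_limitSet_scaledForm_iff`). Limits have this shape because
`h⁻¹ = D⁻¹ hᵀ D` for an isometry `h` of the diagonal form `D`. Conversely, a block triangular
isometry is the product of a block diagonal one, which is an isometry of all the diagonal forms, and
a block unipotent one, which is a product of transvections; each transvection is the limit of
rotations or boosts of a coordinate plane through angles tending to zero. In coordinates adapted to a
flag of forms this group is `Isom(β, F)` (`FlagOfForms.IsAdapted.mem_isom_iff`). So every conjugacy
limit is `Isom(β, F)` for a flag of forms the signatures of which sum to `(p, q)`. Conversely, since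
`Isom(β, F)` does not change when some `βᵢ` are replaced by `-βᵢ`, the diagonal forms above exhibit
it as a limit as soon as its signatures sum to `(p, q)` after exchanges.

That the condition on the signatures is necessary follows because `Isom(β, F)` determines the flag
and, up to nonzero scalars, the forms: the subspaces `Vᵢ` are its only invariant subspaces
(`FlagOfForms.range_space_eq`), and a form on `Vᵢ / Vᵢ₊₁` invariant under it is a multiple of `βᵢ`
(`FlagOfForms.exists_form_eq_smul`).

All the groups concerned consist of matrices of determinant `±1` and contain `-1`. Hence a limit in
the projective group lifts to `GL(n, ℝ)` after normalising determinants, the remaining sign being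
chosen by the ultrafilter (`limitSet_image_mk_subset`), and each of the groups is recovered from its
projective image.
-/

namespace GeometricLimits

/-! ### Limit sets along a filter -/

/-- The set of limits along the filter `l` of the sequences `h` with `h j ∈ H j` for `l`-almost
every `j`. For an ultrafilter `l` this is the ultralimit of the sequence of sets `H`. -/
def limitSet {G : Type*} [TopologicalSpace G] (l : Filter ℕ) (H : ℕ → Set G) : Set G :=
  {g | ∃ h : ℕ → G, (∀ᶠ j in l, h j ∈ H j) ∧ Tendsto h l (𝓝 g)}

theorem exists_forall_mem_of_mem_limitSet {G : Type*} [Group G] [TopologicalSpace G]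
    {l : Filter ℕ} {H : ℕ → Subgroup G} {g : G}
    (hg : g ∈ limitSet l fun j => (H j : Set G)) :
    ∃ h : ℕ → G, (∀ j, h j ∈ H j) ∧ Tendsto h l (𝓝 g) := by
  classical
  obtain ⟨h, hH, hlim⟩ := hg
  refine ⟨fun j => if h j ∈ H j then h j else 1, fun j => ?_, hlim.congr' ?_⟩
  · dsimp only
    split_ifs with hj
    exacts [hj, one_mem _]
  · filter_upwards [hH] with j hj
    exact (if_pos hj).symm

/-- A geometric limit is the ultralimit along every nonprincipal ultrafilter; in particular it is
determined by the sequence. -/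
theorem ConvergesGeometrically.limitSet_eq {G : Type*} [Group G] [TopologicalSpace G]
    {H : ℕ → Subgroup G} {L : Subgroup G} (hL : ConvergesGeometrically H L)
    (U : Ultrafilter ℕ) (hU : (U : Filter ℕ) ≤ atTop) :
    limitSet (U : Filter ℕ) (fun j => (H j : Set G)) = L := by
  obtain ⟨-, -, h1, h2⟩ := hL
  ext g
  constructor
  · intro hg
    obtain ⟨h, hH, hlim⟩ := exists_forall_mem_of_mem_limitSet hg
    exact h2 h hH g (mapClusterPt_iff_ultrafilter.2 ⟨U, hU, hlim⟩)
  · intro hg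
    obtain ⟨h, hH, hlim⟩ := h1 g hg
    exact ⟨h, Eventually.of_forall hH, hlim.mono_left hU⟩

theorem convergesGeometrically_of_limitSet {G : Type*} [Group G] [TopologicalSpace G]
    {H : ℕ → Subgroup G} {L : Subgroup G} (hH : ∀ j, IsClosed (H j : Set G))
    (hL : IsClosed (L : Set G)) (h1 : (L : Set G) ⊆ limitSet atTop fun j => (H j : Set G))
    (h2 : ∀ U : Ultrafilter ℕ, (U : Filter ℕ) ≤ atTop →
      limitSet (U : Filter ℕ) (fun j => (H j : Set G)) ⊆ L) :
    ConvergesGeometrically H L := by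
  refine ⟨hH, hL, fun g hg => exists_forall_mem_of_mem_limitSet (h1 hg), fun h hh g hg => ?_⟩
  obtain ⟨U, hU, hlim⟩ := mapClusterPt_iff_ultrafilter.1 hg
  exact h2 U hU ⟨h, Eventually.of_forall hh, hlim⟩

/-- Conjugating by a convergent sequence conjugates the limit set by the limit. -/
theorem mem_limitSet_conj {G : Type*} [Group G] [TopologicalSpace G] [IsTopologicalGroup G]
    {l : Filter ℕ} {H K : ℕ → Set G} {u : ℕ → G} {v : G} (hu : Tendsto u l (𝓝 v))
    (hHK : ∀ᶠ j in l, ∀ g, g ∈ H j ↔ (u j)⁻¹ * g * u j ∈ K j) (g : G) :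
    g ∈ limitSet l H ↔ v⁻¹ * g * v ∈ limitSet l K := by
  constructor
  · rintro ⟨h, hH, hlim⟩
    refine ⟨fun j => (u j)⁻¹ * h j * u j, ?_, (hu.inv.mul hlim).mul hu⟩
    filter_upwards [hH, hHK] with j h1 h2
    exact (h2 _).1 h1
  · rintro ⟨h, hH, hlim⟩
    refine ⟨fun j => u j * h j * (u j)⁻¹, ?_, ?_⟩
    · filter_upwards [hH, hHK] with j h1 h2
      rw [h2]
      convert h1 using 1
      group
    · convert (hu.mul hlim).mul hu.inv using 2
      group

theorem mem_limitSet_conj_const {G : Type*} [Group G] [TopologicalSpace G] [IsTopologicalGroup G]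
    {l : Filter ℕ} {H K : ℕ → Set G} (v : G)
    (hHK : ∀ j g, g ∈ H j ↔ v⁻¹ * g * v ∈ K j) (g : G) :
    g ∈ limitSet l H ↔ v⁻¹ * g * v ∈ limitSet l K :=
  mem_limitSet_conj tendsto_const_nhds (Eventually.of_forall hHK) g

/-! ### Passing to the projective group -/

section Projective

variable {n : ℕ}

theorem continuous_projGenLinGroup_mk :
    Continuous (ProjGenLinGroup.mk : GL (Fin n) ℝ → PGL(n, ℝ)) :=
  continuous_quot_mk

theorem isOpenQuotientMap_projGenLinGroup_mk :
    IsOpenQuotientMap (ProjGenLinGroup.mk : GL (Fin n) ℝ → PGL(n, ℝ)) :=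
  QuotientGroup.isOpenQuotientMap_mk (N := Subgroup.center (GL (Fin n) ℝ))

/-- The multiple of `g` by a positive scalar with determinant `±1`. -/
noncomputable def normalize (g : GL (Fin n) ℝ) : GL (Fin n) ℝ :=
  g * GeneralLinearGroup.scalar (Fin n)
    (Units.mk0 (|(g : Matrix (Fin n) (Fin n) ℝ).det| ^ (-(n : ℝ)⁻¹)) (by
      have : (g : Matrix (Fin n) (Fin n) ℝ).det ≠ 0 := (GeneralLinearGroup.det g).ne_zero
      positivity))

theorem mk_normalize (g : GL (Fin n) ℝ) :
    ProjGenLinGroup.mk (normalize g) = ProjGenLinGroup.mk g := by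
  simp [normalize]

theorem continuous_normalize : Continuous (normalize : GL (Fin n) ℝ → GL (Fin n) ℝ) := by
  have hdet : Continuous fun g : GL (Fin n) ℝ => |(g : Matrix (Fin n) (Fin n) ℝ).det| :=
    (Units.continuous_val.matrix_det).abs
  have hne : ∀ g : GL (Fin n) ℝ, |(g : Matrix (Fin n) (Fin n) ℝ).det| ≠ 0 := fun g =>
    abs_ne_zero.2 (GeneralLinearGroup.det g).ne_zero
  refine continuous_id.mul ?_
  have hs : Continuous (GeneralLinearGroup.scalar (Fin n) : ℝˣ → GL (Fin n) ℝ) := by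
    refine Continuous.units_map _ ?_
    exact continuous_matrix fun i j => by
      rcases eq_or_ne i j with rfl | hij
      · simpa using continuous_id'
      · simpa [hij] using continuous_const
  refine hs.comp (Units.continuous_iff.2 ⟨?_, ?_⟩)
  · exact hdet.rpow_const fun g => Or.inl (hne g)
  · simp only [Units.val_inv_eq_inv_val, Units.val_mk0]
    exact (hdet.rpow_const fun g => Or.inl (hne g)).inv₀ fun g => by
      have := hne g
      positivity

theorem normalize_mul_scalar {h : GL (Fin n) ℝ} (hh : |(h : Matrix (Fin n) (Fin n) ℝ).det| = 1)
    (z : ℝˣ) : normalize (h * .scalar (Fin n) z) = h ∨ normalize (h * .scalar (Fin n) z) = -h := by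
  rcases Nat.eq_zero_or_pos n with rfl | hn
  · exact Or.inl (Subsingleton.elim _ _)
  have hz : (z : ℝ) ≠ 0 := z.ne_zero
  have hn' : (n : ℝ) ≠ 0 := by positivity
  have hdet : |((h * .scalar (Fin n) z : GL (Fin n) ℝ) : Matrix (Fin n) (Fin n) ℝ).det|
      ^ (-(n : ℝ)⁻¹) = |(z : ℝ)|⁻¹ := by
    have : ((GeneralLinearGroup.scalar (Fin n) z : GL (Fin n) ℝ) : Matrix (Fin n) (Fin n) ℝ).det
        = (z : ℝ) ^ n := by
      simp
    rw [Units.val_mul, det_mul, abs_mul, hh, one_mul, this, abs_pow,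
      ← Real.rpow_natCast, ← Real.rpow_mul (abs_nonneg _), mul_neg, mul_inv_cancel₀ hn',
      Real.rpow_neg_one]
  have key : ∀ i j, (normalize (h * .scalar (Fin n) z) : Matrix (Fin n) (Fin n) ℝ) i j
      = h i j * (z * |(z : ℝ)|⁻¹) := by
    intro i j
    rw [normalize, Units.val_mul, GeneralLinearGroup.coe_scalar, scalar_apply, mul_diagonal,
      Units.val_mk0, hdet, Units.val_mul, GeneralLinearGroup.coe_scalar, scalar_apply,
      mul_diagonal, mul_assoc]
  rcases lt_or_gt_of_ne hz with hz' | hz'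
  · right
    ext i j
    rw [key, abs_of_neg hz', inv_neg, mul_neg, mul_inv_cancel₀ hz]
    simp
  · left
    ext i j
    rw [key, abs_of_pos hz', mul_inv_cancel₀ hz, mul_one]

/-- A subset of the matrices of determinant `±1` which is stable under `-1` is determined by its
image in the projective group. -/
theorem normalize_mem_of_mk_mem {H : Set (GL (Fin n) ℝ)}
    (hdet : ∀ h ∈ H, |(h : Matrix (Fin n) (Fin n) ℝ).det| = 1) (hneg : ∀ h ∈ H, -h ∈ H)
    {g : GL (Fin n) ℝ} (hg : ProjGenLinGroup.mk g ∈ ProjGenLinGroup.mk '' H) :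
    normalize g ∈ H := by
  obtain ⟨h, hh, hhg⟩ := hg
  obtain ⟨z, rfl⟩ := ProjGenLinGroup.mk_eq_mk_iff.1 hhg
  rcases normalize_mul_scalar (hdet h hh) z with h1 | h1 <;> rw [h1]
  exacts [hh, hneg h hh]

theorem isClosed_image_mk {H : Set (GL (Fin n) ℝ)} (hH : IsClosed H)
    (hdet : ∀ h ∈ H, |(h : Matrix (Fin n) (Fin n) ℝ).det| = 1) (hneg : ∀ h ∈ H, -h ∈ H) :
    IsClosed (ProjGenLinGroup.mk '' H : Set PGL(n, ℝ)) := by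
  rw [← isOpenQuotientMap_projGenLinGroup_mk.isQuotientMap.isClosed_preimage]
  have : ProjGenLinGroup.mk ⁻¹' (ProjGenLinGroup.mk '' H : Set PGL(n, ℝ)) = normalize ⁻¹' H := by
    ext g
    refine ⟨fun hg => normalize_mem_of_mk_mem hdet hneg hg, fun hg => ?_⟩
    exact ⟨_, hg, mk_normalize g⟩
  rw [this]
  exact hH.preimage continuous_normalize

theorem image_mk_limitSet_subset (l : Filter ℕ) (H : ℕ → Set (GL (Fin n) ℝ)) :
    (ProjGenLinGroup.mk '' limitSet l H : Set PGL(n, ℝ)) ⊆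
      limitSet l fun j => ProjGenLinGroup.mk '' H j := by
  rintro _ ⟨g, ⟨h, hH, hlim⟩, rfl⟩
  refine ⟨fun j => ProjGenLinGroup.mk (h j), hH.mono fun j hj => ⟨_, hj, rfl⟩, ?_⟩
  exact (continuous_projGenLinGroup_mk.tendsto g).comp hlim

/-- Limits in the projective group along an ultrafilter lift: after normalising determinants only
the sign of a lift is ambiguous, and an ultrafilter chooses it. -/
theorem limitSet_image_mk_subset (U : Ultrafilter ℕ) {H : ℕ → Set (GL (Fin n) ℝ)}
    (hdet : ∀ j, ∀ h ∈ H j, |(h : Matrix (Fin n) (Fin n) ℝ).det| = 1)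
    (hneg : ∀ j, ∀ h ∈ H j, -h ∈ H j) :
    limitSet (U : Filter ℕ) (fun j => (ProjGenLinGroup.mk '' H j : Set PGL(n, ℝ))) ⊆
      ProjGenLinGroup.mk '' limitSet (U : Filter ℕ) H := by
  rintro x ⟨y, hy, hlim⟩
  obtain ⟨g, rfl⟩ := ProjGenLinGroup.mk_surjective x
  choose k hk using fun j => ProjGenLinGroup.mk_surjective (y j)
  set h : ℕ → GL (Fin n) ℝ := fun j => normalize (k j) with hh
  have hhy : ∀ j, ProjGenLinGroup.mk (h j) = y j := fun j => (mk_normalize _).trans (hk j)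
  have hH : ∀ᶠ j in (U : Filter ℕ), h j ∈ H j := hy.mono fun j hj =>
    normalize_mem_of_mk_mem (hdet j) (hneg j) (by rwa [hk])
  have key : Tendsto h U (𝓝 (normalize g)) ∨ Tendsto (fun j => -h j) U (𝓝 (normalize g)) := by
    by_contra! hcon
    obtain ⟨hc1, hc2⟩ := hcon
    simp only [Tendsto, Filter.le_def, not_forall, mem_map] at hc1 hc2
    obtain ⟨V₁, hV₁, hn₁⟩ := hc1
    obtain ⟨V₂, hV₂, hn₂⟩ := hc2
    have hW : ProjGenLinGroup.mk '' (normalize ⁻¹' (V₁ ∩ V₂)) ∈ 𝓝 (ProjGenLinGroup.mk g) :=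
      isOpenQuotientMap_projGenLinGroup_mk.isOpenMap.image_mem_nhds
        (continuous_normalize.continuousAt.preimage_mem_nhds (inter_mem hV₁ hV₂))
    have e₁ := Ultrafilter.compl_mem_iff_notMem.2 hn₁
    have e₂ := Ultrafilter.compl_mem_iff_notMem.2 hn₂
    obtain ⟨j, hj₁, hj₂, hjH, v, hv, hvy⟩ :=
      (Filter.Eventually.and e₁ (Filter.Eventually.and e₂ (hH.and (hlim hW)))).exists
    rw [← hhy] at hvy
    obtain ⟨z, rfl⟩ := ProjGenLinGroup.mk_eq_mk_iff.1 hvy.symm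
    rcases normalize_mul_scalar (hdet j _ hjH) z with h1 | h1
    · exact hj₁ (by simpa [h1] using hv.1)
    · exact hj₂ (by simpa [h1] using hv.2)
  refine ⟨normalize g, ?_, mk_normalize g⟩
  rcases key with h1 | h1
  · exact ⟨h, hH, h1⟩
  · exact ⟨_, hH.mono fun j hj => hneg j _ hj, h1⟩

end Projective

/-! ### Isometry groups of symmetric matrices -/

section Isometries

variable {n : ℕ}

/-- The group of `g ∈ GL(n, ℝ)` with `gᵀ M g = M`, i.e. the isometries of the form `x ↦ xᵀ M x`
when `M` is symmetric. -/
def isometries (M : Matrix (Fin n) (Fin n) ℝ) : Subgroup (GL (Fin n) ℝ) where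
  carrier := {g | (g : Matrix (Fin n) (Fin n) ℝ)ᵀ * M * g = M}
  mul_mem' {a b} ha hb := by
    simp only [Set.mem_ofPred_eq] at ha hb ⊢
    rw [Units.val_mul, transpose_mul]
    calc _ = (b : Matrix (Fin n) (Fin n) ℝ)ᵀ * ((a : Matrix (Fin n) (Fin n) ℝ)ᵀ * M * a) * b := by
          noncomm_ring
      _ = M := by rw [ha, hb]
  one_mem' := by simp
  inv_mem' {a} ha := by
    simp only [Set.mem_ofPred_eq] at ha ⊢
    have h1 : (a : Matrix (Fin n) (Fin n) ℝ) * (a⁻¹ : GL (Fin n) ℝ) = 1 := a.mul_inv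
    have h2 : ((a⁻¹ : GL (Fin n) ℝ) : Matrix (Fin n) (Fin n) ℝ)ᵀ *
        (a : Matrix (Fin n) (Fin n) ℝ)ᵀ = 1 := by
      rw [← transpose_mul, h1, transpose_one]
    conv_lhs => rw [← ha]
    calc _ = (((a⁻¹ : GL (Fin n) ℝ) : Matrix (Fin n) (Fin n) ℝ)ᵀ *
          (a : Matrix (Fin n) (Fin n) ℝ)ᵀ) * M *
          ((a : Matrix (Fin n) (Fin n) ℝ) * (a⁻¹ : GL (Fin n) ℝ)) := by noncomm_ring
      _ = M := by rw [h1, h2, one_mul, mul_one]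

theorem mem_isometries {M : Matrix (Fin n) (Fin n) ℝ} {g : GL (Fin n) ℝ} :
    g ∈ isometries M ↔ (g : Matrix (Fin n) (Fin n) ℝ)ᵀ * M * g = M := Iff.rfl

theorem isClosed_isometries (M : Matrix (Fin n) (Fin n) ℝ) :
    IsClosed (isometries M : Set (GL (Fin n) ℝ)) := by
  refine isClosed_eq (f := fun g : GL (Fin n) ℝ => (g : Matrix (Fin n) (Fin n) ℝ)ᵀ * M * g) ?_
    continuous_const
  have := Units.continuous_val (M := Matrix (Fin n) (Fin n) ℝ)
  fun_prop

theorem mem_isometries_conj {M N : Matrix (Fin n) (Fin n) ℝ} {u : GL (Fin n) ℝ}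
    (h : (u : Matrix (Fin n) (Fin n) ℝ)ᵀ * M * u = N) (g : GL (Fin n) ℝ) :
    g ∈ isometries M ↔ u⁻¹ * g * u ∈ isometries N := by
  have hi : (u : Matrix (Fin n) (Fin n) ℝ) * (u⁻¹ : GL (Fin n) ℝ) = 1 := u.mul_inv
  have hi' : ((u⁻¹ : GL (Fin n) ℝ) : Matrix (Fin n) (Fin n) ℝ)ᵀ *
        (u : Matrix (Fin n) (Fin n) ℝ)ᵀ = 1 := by
      rw [← transpose_mul, hi, transpose_one]
  have key : ((u⁻¹ * g * u : GL (Fin n) ℝ) : Matrix (Fin n) (Fin n) ℝ)ᵀ * N *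
      ((u⁻¹ * g * u : GL (Fin n) ℝ) : Matrix (Fin n) (Fin n) ℝ) =
      (u : Matrix (Fin n) (Fin n) ℝ)ᵀ * ((g : Matrix (Fin n) (Fin n) ℝ)ᵀ * M * g) * u := by
    rw [← h]
    simp only [Units.val_mul, transpose_mul]
    calc _ = (u : Matrix (Fin n) (Fin n) ℝ)ᵀ * (g : Matrix (Fin n) (Fin n) ℝ)ᵀ *
          (((u⁻¹ : GL (Fin n) ℝ) : Matrix (Fin n) (Fin n) ℝ)ᵀ *
          (u : Matrix (Fin n) (Fin n) ℝ)ᵀ) * M *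
          ((u : Matrix (Fin n) (Fin n) ℝ) * (u⁻¹ : GL (Fin n) ℝ)) * g * u := by noncomm_ring
      _ = _ := by rw [hi, hi']; noncomm_ring
  rw [mem_isometries, mem_isometries, key, ← h]
  constructor
  · intro hg
    rw [hg]
  · intro hg
    have := congrArg (fun X => ((u⁻¹ : GL (Fin n) ℝ) : Matrix (Fin n) (Fin n) ℝ)ᵀ * X *
      ((u⁻¹ : GL (Fin n) ℝ) : Matrix (Fin n) (Fin n) ℝ)) hg
    have e : ∀ X : Matrix (Fin n) (Fin n) ℝ, ((u⁻¹ : GL (Fin n) ℝ) : Matrix (Fin n) (Fin n) ℝ)ᵀ *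
        ((u : Matrix (Fin n) (Fin n) ℝ)ᵀ * X * u) *
        ((u⁻¹ : GL (Fin n) ℝ) : Matrix (Fin n) (Fin n) ℝ) = X := fun X => by
      calc _ = (((u⁻¹ : GL (Fin n) ℝ) : Matrix (Fin n) (Fin n) ℝ)ᵀ *
          (u : Matrix (Fin n) (Fin n) ℝ)ᵀ) * X *
          ((u : Matrix (Fin n) (Fin n) ℝ) * (u⁻¹ : GL (Fin n) ℝ)) := by noncomm_ring
        _ = X := by rw [hi, hi', one_mul, mul_one]
    simpa only [e] using this

/-- A diagonal form is determined by its values: a matrix preserves the quadratic form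
`∑ dₐ xₐ²` if and only if it preserves the corresponding bilinear form. -/
theorem mem_isometries_diagonal {d : Fin n → ℝ} {g : GL (Fin n) ℝ} :
    g ∈ isometries (diagonal d) ↔
      ∀ x : Fin n → ℝ, ∑ a, d a * ((g : Matrix (Fin n) (Fin n) ℝ) *ᵥ x) a ^ 2 =
        ∑ a, d a * x a ^ 2 := by
  have hd : ∀ x y : Fin n → ℝ, x ⬝ᵥ (diagonal d *ᵥ y) = ∑ a, d a * (x a * y a) := fun x y => by
    simp only [dotProduct, mulVec_diagonal]
    exact Finset.sum_congr rfl fun a _ => by ring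
  have hq : ∀ x : Fin n → ℝ, ∑ a, d a * x a ^ 2 = x ⬝ᵥ (diagonal d *ᵥ x) := fun x => by
    rw [hd]
    exact Finset.sum_congr rfl fun a _ => by ring
  have hg : ∀ x y : Fin n → ℝ, ((g : Matrix (Fin n) (Fin n) ℝ) *ᵥ x) ⬝ᵥ
      (diagonal d *ᵥ ((g : Matrix (Fin n) (Fin n) ℝ) *ᵥ y)) =
      x ⬝ᵥ (((g : Matrix (Fin n) (Fin n) ℝ)ᵀ * diagonal d * (g : Matrix (Fin n) (Fin n) ℝ)) *ᵥ y) := fun x y => by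
    rw [dotProduct_comm, ← dotProduct_transpose_mulVec, mulVec_mulVec, mulVec_mulVec,
      dotProduct_comm]
  constructor
  · intro h x
    rw [hq, hq, hg, mem_isometries.1 h]
  · intro h
    rw [mem_isometries]
    have hsymm : ∀ x y : Fin n → ℝ, ((g : Matrix (Fin n) (Fin n) ℝ) *ᵥ x) ⬝ᵥ
        (diagonal d *ᵥ ((g : Matrix (Fin n) (Fin n) ℝ) *ᵥ y)) = x ⬝ᵥ (diagonal d *ᵥ y) := by
      intro x y
      have h1 := h (x + y)
      have h2 := h x
      have h3 := h y
      rw [hd, hd]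
      simp only [mulVec_add, Pi.add_apply, add_sq, mul_add, Finset.sum_add_distrib] at h1
      have e : ∀ u v : Fin n → ℝ, ∑ a, d a * (2 * u a * v a) = 2 * ∑ a, d a * (u a * v a) :=
        fun u v => by
          rw [Finset.mul_sum]
          exact Finset.sum_congr rfl fun a _ => by ring
      rw [e, e] at h1
      linarith
    refine ext_iff_mulVec.2 fun y => ?_
    refine dotProduct_eq _ _ fun x => ?_
    rw [dotProduct_comm, ← hg, hsymm, dotProduct_comm]

end Isometries

theorem tendsto_GL_iff {n : ℕ} {α : Type*} {l : Filter α} {h : α → GL (Fin n) ℝ}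
    {g : GL (Fin n) ℝ} : Tendsto h l (𝓝 g) ↔
      Tendsto (fun j => (h j : Matrix (Fin n) (Fin n) ℝ)) l (𝓝 g) := by
  let _ : NormedRing (Matrix (Fin n) (Fin n) ℝ) := Matrix.linftyOpNormedRing
  let _ : NormedAlgebra ℝ (Matrix (Fin n) (Fin n) ℝ) := Matrix.linftyOpNormedAlgebra
  have : CompleteSpace (Matrix (Fin n) (Fin n) ℝ) := FiniteDimensional.complete ℝ _
  exact (Units.isOpenEmbedding_val (R := Matrix (Fin n) (Fin n) ℝ)).isEmbedding.tendsto_nhds_iff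

theorem mem_limitSet_of_tendsto_val {n : ℕ} {l : Filter ℕ} {H : ℕ → Set (GL (Fin n) ℝ)}
    {g : GL (Fin n) ℝ} {A : ℕ → Matrix (Fin n) (Fin n) ℝ} (hA : Tendsto A l (𝓝 g))
    (hH : ∀ᶠ j in l, ∃ h ∈ H j, (h : Matrix (Fin n) (Fin n) ℝ) = A j) : g ∈ limitSet l H := by
  classical
  refine ⟨fun j => if hj : ∃ h ∈ H j, (h : Matrix (Fin n) (Fin n) ℝ) = A j then hj.choose else 1,
    ?_, ?_⟩
  · filter_upwards [hH] with j hj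
    rw [dif_pos hj]
    exact hj.choose_spec.1
  · refine tendsto_GL_iff.2 (hA.congr' ?_)
    filter_upwards [hH] with j hj
    rw [dif_pos hj]
    exact hj.choose_spec.2.symm

theorem mul_mem_limitSet {G : Type*} [Group G] [TopologicalSpace G] [IsTopologicalGroup G]
    {l : Filter ℕ} {H : ℕ → Subgroup G} {g g' : G} (hg : g ∈ limitSet l fun j => (H j : Set G))
    (hg' : g' ∈ limitSet l fun j => (H j : Set G)) :
    g * g' ∈ limitSet l fun j => (H j : Set G) := by
  obtain ⟨h, hh, hlim⟩ := hg
  obtain ⟨h', hh', hlim'⟩ := hg'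
  exact ⟨fun j => h j * h' j, (hh.and hh').mono fun j hj => mul_mem hj.1 hj.2, hlim.mul hlim'⟩

/-! ### Linear maps supported in a coordinate plane -/

section Plane

variable {n : ℕ}

/-- The matrix acting on the coordinate plane `(a, b)` by `!![c, s; t, c]` and fixing the other
coordinates. -/
def planeMatrix (a b : Fin n) (c s t : ℝ) : Matrix (Fin n) (Fin n) ℝ :=
  1 + single a a (c - 1) + single b b (c - 1) + single a b s + single b a t

theorem planeMatrix_mulVec {a b : Fin n} (hab : a ≠ b) (c s t : ℝ) (x : Fin n → ℝ) :
    planeMatrix a b c s t *ᵥ x = fun i => if i = a then c * x a + s * x b else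
      if i = b then t * x a + c * x b else x i := by
  ext i
  simp only [planeMatrix, add_mulVec, one_mulVec, Pi.add_apply, single_mulVec, Function.update_apply,
    Pi.zero_apply]
  split_ifs with h1 h2 h3
  · exact absurd (h1.symm.trans h2) hab
  · subst h1; ring
  · subst h3; ring
  · ring

theorem planeMatrix_mul_planeMatrix {a b : Fin n} (hab : a ≠ b) {c s t : ℝ}
    (h : c * c - s * t = 1) : planeMatrix a b c s t * planeMatrix a b c (-s) (-t) = 1 := by
  refine ext_iff_mulVec.2 fun x => ?_
  rw [← mulVec_mulVec, planeMatrix_mulVec hab, planeMatrix_mulVec hab, one_mulVec]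
  ext i
  simp only [if_true, if_neg hab.symm]
  split_ifs with h1 h2
  · subst h1; linear_combination x i * h
  · subst h2; linear_combination x i * h
  · rfl

/-- `planeMatrix` with determinant one, as an element of the general linear group. -/
def planeGL (a b : Fin n) (hab : a ≠ b) (c s t : ℝ) (h : c * c - s * t = 1) : GL (Fin n) ℝ where
  val := planeMatrix a b c s t
  inv := planeMatrix a b c (-s) (-t)
  val_inv := planeMatrix_mul_planeMatrix hab h
  inv_val := by simpa using planeMatrix_mul_planeMatrix hab (c := c) (s := -s) (t := -t) (by simpa)

@[simp]
theorem coe_planeGL (a b : Fin n) (hab : a ≠ b) (c s t : ℝ) (h : c * c - s * t = 1) :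
    (planeGL a b hab c s t h : Matrix (Fin n) (Fin n) ℝ) = planeMatrix a b c s t := rfl

theorem sum_eq_add_add_sum_erase {a b : Fin n} (hab : a ≠ b) (f : Fin n → ℝ) :
    ∑ i, f i = f a + f b + ∑ i ∈ (Finset.univ.erase a).erase b, f i := by
  rw [← Finset.add_sum_erase _ f (Finset.mem_univ a),
    ← Finset.add_sum_erase _ f (Finset.mem_erase.2 ⟨hab.symm, Finset.mem_univ b⟩), add_assoc]

/-- The rotation (`κ > 0`) or boost (`κ < 0`) of the plane `(a, b)` is an isometry. -/
theorem planeGL_mem_isometries {a b : Fin n} (hab : a ≠ b) {d : Fin n → ℝ} {c t κ : ℝ}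
    (hκ : d a * κ = d b) (h : c * c - -(κ * t) * t = 1) :
    planeGL a b hab c (-(κ * t)) t h ∈ isometries (diagonal d) := by
  rw [mem_isometries_diagonal]
  intro x
  rw [coe_planeGL, planeMatrix_mulVec hab, sum_eq_add_add_sum_erase hab,
    sum_eq_add_add_sum_erase hab]
  congr 1
  · simp only [if_true, if_neg hab.symm, ← hκ]
    linear_combination (d a * x a ^ 2 + d a * κ * x b ^ 2) * h
  · refine Finset.sum_congr rfl fun i hi => ?_
    simp only [Finset.mem_erase] at hi
    simp only [if_neg hi.2.1, if_neg hi.1]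

end Plane

/-! ### Block triangular isometries -/

section BlockIsometry

variable {n m : ℕ} {w : Fin n → Fin m} {ε : Fin n → ℝ}

/-- The coordinates are sorted into classes by `w`. The matrix `g` is block triangular, preserving
the span of the coordinates of class at least `i` for every `i`, and its diagonal blocks are
isometries of the restrictions of the form `∑ εₐ xₐ²` to the classes. -/
structure IsBlockIsometry (w : Fin n → Fin m) (ε : Fin n → ℝ) (g : Matrix (Fin n) (Fin n) ℝ) :
    Prop where
  blockTriangular : g.BlockTriangular (OrderDual.toDual ∘ w)
  block : ∀ a b, w a = w b →
    ∑ c with w c = w a, ε c * (g c a * g c b) = if a = b then ε a else 0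

theorem blockTriangular_toDual_iff {g : Matrix (Fin n) (Fin n) ℝ} :
    g.BlockTriangular (OrderDual.toDual ∘ w) ↔ ∀ a b, w b < w a → g b a = 0 :=
  ⟨fun h a b hab => h (by simpa using hab), fun h b a hab => h a b (by simpa using hab)⟩

theorem blockTriangular_inv {g : GL (Fin n) ℝ}
    (hg : (g : Matrix (Fin n) (Fin n) ℝ).BlockTriangular (OrderDual.toDual ∘ w)) :
    ((g⁻¹ : GL (Fin n) ℝ) : Matrix (Fin n) (Fin n) ℝ).BlockTriangular (OrderDual.toDual ∘ w) := by
  have : Invertible (g : Matrix (Fin n) (Fin n) ℝ) := g.invertible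
  rw [Matrix.coe_units_inv]
  exact blockTriangular_inv_of_blockTriangular hg

theorem isClosed_isBlockIsometry :
    IsClosed {g : GL (Fin n) ℝ | IsBlockIsometry w ε (g : Matrix (Fin n) (Fin n) ℝ)} := by
  have hc := Units.continuous_val (M := Matrix (Fin n) (Fin n) ℝ)
  have : {g : GL (Fin n) ℝ | IsBlockIsometry w ε (g : Matrix (Fin n) (Fin n) ℝ)} =
      {g : GL (Fin n) ℝ | ∀ a b, w b < w a → (g : Matrix (Fin n) (Fin n) ℝ) b a = 0} ∩
      {g : GL (Fin n) ℝ | ∀ a b, w a = w b → ∑ c with w c = w a, ε c * (g c a * g c b) =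
        if a = b then ε a else 0} := by
    ext g
    exact ⟨fun h => ⟨blockTriangular_toDual_iff.1 h.1, h.2⟩,
      fun h => ⟨blockTriangular_toDual_iff.2 h.1, h.2⟩⟩
  rw [this]
  refine IsClosed.inter ?_ ?_
  · simp only [Set.ofPred_forall]
    refine isClosed_iInter fun a => isClosed_iInter fun b => isClosed_iInter fun _ =>
      isClosed_eq (hc.matrix_elem b a) continuous_const
  · simp only [Set.ofPred_forall]
    refine isClosed_iInter fun a => isClosed_iInter fun b => isClosed_iInter fun _ =>
      isClosed_eq (continuous_finsetSum _ fun c _ => continuous_const.mul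
        ((hc.matrix_elem c a).mul (hc.matrix_elem c b))) continuous_const

/-! ### Limits of the isometry groups of diagonal forms -/

/-- The diagonal form with signs `ε` in which the coordinates of class `i` have size `s i`. -/
def scaledForm (w : Fin n → Fin m) (ε : Fin n → ℝ) (s : Fin m → ℝ) : Matrix (Fin n) (Fin n) ℝ :=
  diagonal fun a => ε a * s (w a)

/-- For an isometry of a diagonal form, the entries of the inverse are rescaled entries of the
transpose. -/
theorem apply_inv_of_mem_isometries_diagonal {d : Fin n → ℝ} {h : GL (Fin n) ℝ}
    (hh : h ∈ isometries (diagonal d)) (a b : Fin n) :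
    d a * (h⁻¹ : GL (Fin n) ℝ) a b = h b a * d b := by
  have e : diagonal d * (h⁻¹ : GL (Fin n) ℝ) = (h : Matrix (Fin n) (Fin n) ℝ)ᵀ * diagonal d := by
    conv_lhs => rw [← mem_isometries.1 hh]
    rw [Matrix.mul_assoc, Units.mul_inv, Matrix.mul_one]
  simpa using congrFun (congrFun e a) b

theorem tendsto_apply {l : Filter ℕ} {h : ℕ → GL (Fin n) ℝ} {g : GL (Fin n) ℝ}
    (hlim : Tendsto h l (𝓝 g)) (a b : Fin n) : Tendsto (fun j => h j a b) l (𝓝 (g a b)) :=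
  ((tendsto_GL_iff.1 hlim).apply_nhds a).apply_nhds b

/-- A limit of isometries of diagonal forms, the sizes of whose blocks separate in the limit, is
a block triangular isometry. -/
theorem isBlockIsometry_of_mem_limitSet (hε : ∀ a, ε a ≠ 0) {s : ℕ → Fin m → ℝ} {l : Filter ℕ}
    [l.NeBot] (hs : ∀ j i, 0 < s j i)
    (hlim : ∀ i i', i < i' → Tendsto (fun j => s j i' / s j i) l (𝓝 0)) {g : GL (Fin n) ℝ}
    (hg : g ∈ limitSet l fun j => (isometries (scaledForm w ε (s j)) : Set (GL (Fin n) ℝ))) :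
    IsBlockIsometry w ε (g : Matrix (Fin n) (Fin n) ℝ) := by
  obtain ⟨h, hh, hconv⟩ := hg
  have hinv := hconv.inv
  have htri : (g : Matrix (Fin n) (Fin n) ℝ).BlockTriangular (OrderDual.toDual ∘ w) := by
    refine blockTriangular_toDual_iff.2 fun a b hab => ?_
    have h1 : Tendsto (fun j => ε a / ε b * (s j (w a) / s j (w b)) * (h j)⁻¹ a b) l
        (𝓝 (ε a / ε b * 0 * g⁻¹ a b)) :=
      ((hlim _ _ hab).const_mul _).mul (tendsto_apply hinv a b)
    rw [mul_zero, zero_mul] at h1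
    refine tendsto_nhds_unique (tendsto_apply hconv b a) (h1.congr' ?_)
    filter_upwards [hh] with j hj
    have := apply_inv_of_mem_isometries_diagonal hj a b
    have h2 := hε b
    have h3 := (hs j (w b)).ne'
    field_simp
    linear_combination this
  refine ⟨htri, fun a b hab => ?_⟩
  have hsym : ∀ c, w c = w a → ε c * g c a = ε a * g⁻¹ a c := fun c hc => by
    refine tendsto_nhds_unique ((tendsto_apply hconv c a).const_mul _)
      (((tendsto_apply hinv a c).const_mul _).congr' ?_)
    filter_upwards [hh] with j hj
    have := apply_inv_of_mem_isometries_diagonal hj a c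
    rw [hc] at this
    have h3 := (hs j (w a)).ne'
    refine mul_right_cancel₀ h3 ?_
    linear_combination this
  have htri' := blockTriangular_toDual_iff.1 (blockTriangular_inv htri)
  have htri := blockTriangular_toDual_iff.1 htri
  calc ∑ c with w c = w a, ε c * (g c a * g c b)
      = ∑ c with w c = w a, ε a * (g⁻¹ a c * g c b) := by
        refine Finset.sum_congr rfl fun c hc => ?_
        rw [← mul_assoc, hsym c (Finset.mem_filter.1 hc).2, mul_assoc]
    _ = ∑ c, ε a * (g⁻¹ a c * g c b) := by
        refine Finset.sum_filter_of_ne fun c _ hne => ?_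
        by_contra hc
        rcases lt_or_gt_of_ne hc with hc | hc
        · exact hne (by rw [htri b c (hab ▸ hc)]; simp)
        · exact hne (by rw [htri' c a hc]; simp)
    _ = ε a * ((g⁻¹ * g : GL (Fin n) ℝ) : Matrix (Fin n) (Fin n) ℝ) a b := by
        rw [Units.val_mul, mul_apply, Finset.mul_sum]
    _ = if a = b then ε a else 0 := by
        rw [inv_mul_cancel, Units.val_one, one_apply]
        split_ifs <;> simp

/-- The transvection adding `t` times the coordinate `a` to the coordinate `b`, which belongs to a
smaller block, is a limit of rotations or boosts through small angles. -/
theorem transvection_mem_limitSet (hε : ∀ a, ε a ≠ 0) {s : ℕ → Fin m → ℝ} {l : Filter ℕ}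
    (hs : ∀ j i, 0 < s j i)
    (hlim : ∀ i i', i < i' → Tendsto (fun j => s j i' / s j i) l (𝓝 0)) {a b : Fin n}
    (hab : a ≠ b) (hw : w a < w b) (t : ℝ) :
    planeGL a b hab 1 0 t (by simp) ∈
      limitSet l fun j => (isometries (scaledForm w ε (s j)) : Set (GL (Fin n) ℝ)) := by
  have hκ : Tendsto (fun j => ε b / ε a * (s j (w b) / s j (w a))) l (𝓝 0) := by
    simpa using (hlim _ _ hw).const_mul (ε b / ε a)
  set κ : ℕ → ℝ := fun j => ε b / ε a * (s j (w b) / s j (w a)) with hκdef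
  have h1 : Tendsto (fun j => 1 - κ j * t ^ 2) l (𝓝 1) := by
    simpa using (hκ.mul_const (t ^ 2)).const_sub 1
  refine mem_limitSet_of_tendsto_val
    (A := fun j => planeMatrix a b (√(1 - κ j * t ^ 2)) (-(κ j * t)) t) ?_ ?_
  · have h2 : Tendsto (fun j => √(1 - κ j * t ^ 2)) l (𝓝 1) := by simpa using h1.sqrt
    have h3 : Tendsto (fun j => -(κ j * t)) l (𝓝 0) := by simpa using (hκ.mul_const t).neg
    have hcont : Continuous fun p : ℝ × ℝ => planeMatrix a b p.1 p.2 t := by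
      refine continuous_matrix fun x y => ?_
      simp only [planeMatrix, Matrix.add_apply, single_apply]
      refine (((continuous_const.add ?_).add ?_).add ?_).add continuous_const <;>
        split_ifs <;> fun_prop
    have := (hcont.tendsto (1, 0)).comp (h2.prodMk_nhds h3)
    exact this
  · filter_upwards [h1.eventually (lt_mem_nhds one_pos)] with j hj
    refine ⟨planeGL a b hab (√(1 - κ j * t ^ 2)) (-(κ j * t)) t ?_, ?_, rfl⟩
    · rw [Real.mul_self_sqrt hj.le]
      ring
    · refine planeGL_mem_isometries hab ?_ _
      have h2 := hε a
      have h3 := (hs j (w a)).ne'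
      simp only [hκdef]
      field_simp

theorem planeMatrix_mul_apply {a b : Fin n} (hab : a ≠ b) (t : ℝ)
    (M : Matrix (Fin n) (Fin n) ℝ) (x y : Fin n) :
    (planeMatrix a b 1 0 t * M) x y = if x = b then t * M a y + M b y else M x y := by
  have : (planeMatrix a b 1 0 t * M) x y = (planeMatrix a b 1 0 t *ᵥ (fun z => M z y)) x := rfl
  rw [this, planeMatrix_mulVec hab]
  by_cases hx : x = a
  · subst hx; simp [hab]
  · simp [hx]

/-- Transvections generate the block unipotent matrices: the lowest-class column with a nonzero
off-diagonal entry can be cleared by row operations which change no other entry. -/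
theorem mem_of_forall_transvection_mem {S : Set (GL (Fin n) ℝ)} (hone : 1 ∈ S)
    (hmul : ∀ g ∈ S, ∀ h ∈ S, g * h ∈ S)
    (htr : ∀ a b (hab : a ≠ b) (t : ℝ), w a < w b → planeGL a b hab 1 0 t (by simp) ∈ S)
    (g : GL (Fin n) ℝ) (hdiag : ∀ a, g a a = 1)
    (hoff : ∀ a b, a ≠ b → ¬ w a < w b → g b a = 0) : g ∈ S := by
  classical
  induction hN : (Finset.univ.filter fun p : Fin n × Fin n => p.1 ≠ p.2 ∧ g p.1 p.2 ≠ 0).card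
    using Nat.strong_induction_on generalizing g with
  | _ N ih =>
  set T := Finset.univ.filter fun p : Fin n × Fin n => p.1 ≠ p.2 ∧ g p.1 p.2 ≠ 0 with hT
  rcases T.eq_empty_or_nonempty with h0 | h0
  · convert hone
    ext x y
    by_cases hxy : x = y
    · subst hxy; simp [hdiag]
    · have : (x, y) ∉ T := h0 ▸ Finset.notMem_empty _
      simp only [hT, Finset.mem_filter_univ, not_and, not_not] at this
      simp [hxy, this hxy]
  · obtain ⟨⟨b, a⟩, hba, hmin⟩ := T.exists_min_image (fun p => w p.2) h0
    have hba' : b ≠ a ∧ g b a ≠ 0 := by simpa [hT] using hba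
    have hab : a ≠ b := hba'.1.symm
    have hw : w a < w b := by
      by_contra h
      exact hba'.2 (hoff a b hab h)
    -- the row `a` of `g` is a standard basis vector, by minimality of `w a`
    have hrow : ∀ c, c ≠ a → g a c = 0 := by
      intro c hc
      by_contra hne
      have h1 : w c < w a := by
        by_contra h
        exact hne (hoff c a hc h)
      have := hmin (a, c) (by simpa [hT] using ⟨hc.symm, hne⟩)
      exact absurd h1 this.not_gt
    set P := planeGL a b hab 1 0 (g b a) (by simp) with hP
    have hPinv : ((P⁻¹ * g : GL (Fin n) ℝ) : Matrix (Fin n) (Fin n) ℝ) =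
        planeMatrix a b 1 0 (-g b a) * (g : Matrix (Fin n) (Fin n) ℝ) := by
      rw [Units.val_mul]
      congr 1
      change planeMatrix a b 1 (-0) (-g b a) = _
      rw [neg_zero]
    have hent : ∀ x y, (P⁻¹ * g : GL (Fin n) ℝ) x y = if x = b ∧ y = a then 0 else g x y := by
      intro x y
      rw [hPinv, planeMatrix_mul_apply hab]
      by_cases hx : x = b
      · subst hx
        by_cases hy : y = a
        · subst hy; simp [hdiag]
        · simp [hy, hrow y hy]
      · simp [hx]
    have hmem : P⁻¹ * g ∈ S := by
      refine ih _ ?_ (P⁻¹ * g) (fun c => ?_) (fun c d hcd hwcd => ?_) rfl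
      · rw [← hN]
        refine Finset.card_lt_card (Finset.ssubset_iff_subset_ne.2 ⟨fun p hp => ?_, fun heq => ?_⟩)
        · simp only [Finset.mem_filter_univ, hent, hT] at hp ⊢
          refine ⟨hp.1, fun h => hp.2 ?_⟩
          simp [h]
        · rw [← heq] at hba
          simp [hent] at hba
      · rw [hent, if_neg (fun h => hab (h.2.symm.trans h.1)), hdiag]
      · rw [hent]
        split_ifs
        exacts [rfl, hoff c d hcd hwcd]
    have := hmul P (htr a b hab _ hw) _ hmem
    rwa [mul_inv_cancel_left] at this

/-- The block diagonal part of a matrix. -/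
def blockDiagPart (w : Fin n → Fin m) (g : Matrix (Fin n) (Fin n) ℝ) : Matrix (Fin n) (Fin n) ℝ :=
  of fun b a => if w b = w a then g b a else 0

theorem blockDiagPart_mul {g h : Matrix (Fin n) (Fin n) ℝ}
    (hg : g.BlockTriangular (OrderDual.toDual ∘ w))
    (hh : h.BlockTriangular (OrderDual.toDual ∘ w)) :
    blockDiagPart w (g * h) = blockDiagPart w g * blockDiagPart w h := by
  rw [blockTriangular_toDual_iff] at hg hh
  ext x y
  simp only [blockDiagPart, of_apply, mul_apply]
  split_ifs with hxy
  · refine Finset.sum_congr rfl fun z _ => ?_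
    by_cases hz : w x = w z
    · rw [if_pos hz, if_pos (hz ▸ hxy)]
    · rw [if_neg hz, zero_mul]
      rcases lt_or_gt_of_ne hz with hz | hz
      · rw [hg z x hz, zero_mul]
      · rw [hh y z (hxy ▸ hz), mul_zero]
  · refine (Finset.sum_eq_zero fun z _ => ?_).symm
    by_cases hz : w x = w z
    · rw [if_neg (fun h => hxy (hz.trans h)), mul_zero]
    · rw [if_neg hz, zero_mul]

@[simp]
theorem blockDiagPart_one : blockDiagPart w (1 : Matrix (Fin n) (Fin n) ℝ) = 1 := by
  ext x y
  by_cases hxy : x = y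
  · subst hxy; simp [blockDiagPart]
  · simp [blockDiagPart, hxy]

@[simp]
theorem blockDiagPart_blockDiagPart (g : Matrix (Fin n) (Fin n) ℝ) :
    blockDiagPart w (blockDiagPart w g) = blockDiagPart w g := by
  ext x y
  simp only [blockDiagPart, of_apply]
  split_ifs <;> rfl

theorem blockTriangular_blockDiagPart (g : Matrix (Fin n) (Fin n) ℝ) :
    (blockDiagPart w g).BlockTriangular (OrderDual.toDual ∘ w) :=
  blockTriangular_toDual_iff.2 fun _ _ hab => if_neg hab.ne

/-- Every block triangular isometry is a limit: its block diagonal part is an isometry of all the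
diagonal forms, and the remaining factor is block unipotent. -/
theorem mem_limitSet_of_isBlockIsometry (hε : ∀ a, ε a ≠ 0) {s : ℕ → Fin m → ℝ} {l : Filter ℕ}
    (hs : ∀ j i, 0 < s j i)
    (hlim : ∀ i i', i < i' → Tendsto (fun j => s j i' / s j i) l (𝓝 0)) {g : GL (Fin n) ℝ}
    (hg : IsBlockIsometry w ε (g : Matrix (Fin n) (Fin n) ℝ)) :
    g ∈ limitSet l fun j => (isometries (scaledForm w ε (s j)) : Set (GL (Fin n) ℝ)) := by
  have hg1 := hg.blockTriangular
  have hg2 := blockTriangular_inv hg1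
  have hinv1 : blockDiagPart w (g : Matrix (Fin n) (Fin n) ℝ) *
      blockDiagPart w (g⁻¹ : GL (Fin n) ℝ) = 1 := by
    rw [← blockDiagPart_mul hg1 hg2, Units.mul_inv, blockDiagPart_one]
  have hinv2 : blockDiagPart w ((g⁻¹ : GL (Fin n) ℝ) : Matrix (Fin n) (Fin n) ℝ) *
      blockDiagPart w (g : Matrix (Fin n) (Fin n) ℝ) = 1 := by
    rw [← blockDiagPart_mul hg2 hg1, Units.inv_mul, blockDiagPart_one]
  let A : GL (Fin n) ℝ := ⟨_, _, hinv1, hinv2⟩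
  have hA : A ∈ limitSet l fun j => (isometries (scaledForm w ε (s j)) : Set (GL (Fin n) ℝ)) := by
    refine ⟨fun _ => A, Eventually.of_forall fun j => ?_, tendsto_const_nhds⟩
    change (blockDiagPart w (g : Matrix (Fin n) (Fin n) ℝ))ᵀ * scaledForm w ε (s j) *
      blockDiagPart w (g : Matrix (Fin n) (Fin n) ℝ) = _
    ext a b
    rw [scaledForm, mul_apply]
    simp only [mul_diagonal, transpose_apply, blockDiagPart, of_apply, diagonal_apply]
    by_cases hab : w a = w b
    · have h1 := hg.block a b hab
      rw [Finset.sum_filter] at h1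
      calc _ = (∑ c, if w c = w a then ε c * (g c a * g c b) else 0) * s j (w a) := by
            rw [Finset.sum_mul]
            refine Finset.sum_congr rfl fun c _ => ?_
            by_cases hc : w c = w a
            · rw [if_pos hc, if_pos (hc.trans hab), if_pos hc, hc]
              ring
            · rw [if_neg hc, if_neg hc]
              ring
        _ = _ := by
            rw [h1]
            split_ifs <;> simp
    · rw [if_neg (fun h => hab (congrArg w h))]
      refine Finset.sum_eq_zero fun c _ => ?_
      by_cases hc : w c = w a
      · rw [if_neg (fun h => hab (hc.symm.trans h)), mul_zero]
      · rw [if_neg hc, zero_mul, zero_mul]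
  have hu : A⁻¹ * g ∈
      limitSet l fun j => (isometries (scaledForm w ε (s j)) : Set (GL (Fin n) ℝ)) := by
    have hval : ((A⁻¹ * g : GL (Fin n) ℝ) : Matrix (Fin n) (Fin n) ℝ) =
        blockDiagPart w ((g⁻¹ : GL (Fin n) ℝ) : Matrix (Fin n) (Fin n) ℝ) * g := rfl
    have htri : ((A⁻¹ * g : GL (Fin n) ℝ) : Matrix (Fin n) (Fin n) ℝ).BlockTriangular
        (OrderDual.toDual ∘ w) := by
      rw [hval]
      exact (blockTriangular_blockDiagPart _).mul hg1
    have hone : blockDiagPart w ((A⁻¹ * g : GL (Fin n) ℝ) : Matrix (Fin n) (Fin n) ℝ) = 1 := by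
      rw [hval, blockDiagPart_mul (blockTriangular_blockDiagPart _) hg1,
        blockDiagPart_blockDiagPart, hinv2]
    have hent : ∀ x y, w x = w y →
        (A⁻¹ * g : GL (Fin n) ℝ) x y = (1 : Matrix (Fin n) (Fin n) ℝ) x y := fun x y hxy => by
      rw [← hone, blockDiagPart, of_apply, if_pos hxy]
    refine mem_of_forall_transvection_mem (w := w)
      (S := limitSet l fun j => (isometries (scaledForm w ε (s j)) : Set (GL (Fin n) ℝ)))
      ⟨1, Eventually.of_forall fun j => one_mem _, tendsto_const_nhds⟩
      (fun g hg h hh => mul_mem_limitSet hg hh)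
      (fun a b hab t hw => transvection_mem_limitSet hε hs hlim hab hw t) _ (fun a => ?_)
      (fun a b hab hw => ?_)
    · rw [hent a a rfl, one_apply_eq]
    · rcases (not_lt.1 hw).lt_or_eq with h | h
      · exact blockTriangular_toDual_iff.1 htri a b h
      · rw [hent b a h, one_apply_ne hab.symm]
  have := mul_mem_limitSet hA hu
  rwa [mul_inv_cancel_left] at this

/-- When the sizes of the blocks separate along `l`, the isometry groups of the diagonal forms
converge to the group of block triangular isometries. -/
theorem mem_limitSet_scaledForm_iff (hε : ∀ a, ε a ≠ 0) {s : ℕ → Fin m → ℝ} {l : Filter ℕ}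
    [l.NeBot] (hs : ∀ j i, 0 < s j i)
    (hlim : ∀ i i', i < i' → Tendsto (fun j => s j i' / s j i) l (𝓝 0)) {g : GL (Fin n) ℝ} :
    g ∈ limitSet l (fun j => (isometries (scaledForm w ε (s j)) : Set (GL (Fin n) ℝ))) ↔
      IsBlockIsometry w ε (g : Matrix (Fin n) (Fin n) ℝ) :=
  ⟨isBlockIsometry_of_mem_limitSet hε hs hlim, mem_limitSet_of_isBlockIsometry hε hs hlim⟩

end BlockIsometry

/-! ### Degenerations of a diagonal form along an ultrafilter -/

section Degeneration

variable {n : ℕ}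

/-- Sylvester's law of inertia for congruent diagonal matrices. -/
theorem ncard_eq_of_congruent {d e : Fin n → ℝ} {P : GL (Fin n) ℝ}
    (h : (P : Matrix (Fin n) (Fin n) ℝ)ᵀ * diagonal d * P = diagonal e) :
    {a | e a < 0}.ncard = {a | d a < 0}.ncard ∧ {a | 0 < e a}.ncard = {a | 0 < d a}.ncard := by
  have hq : ∀ (f x : Fin n → ℝ), QuadraticMap.weightedSumSquares ℝ f x =
      x ⬝ᵥ (diagonal f *ᵥ x) := fun f x => by
    simp only [QuadraticMap.weightedSumSquares_apply, smul_eq_mul, dotProduct, mulVec_diagonal]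
    exact Finset.sum_congr rfl fun a _ => by ring
  have hE : (QuadraticMap.weightedSumSquares ℝ e).Equivalent
      (QuadraticMap.weightedSumSquares ℝ d) := by
    refine ⟨{ toLinearEquiv := Matrix.toLinearEquiv' (P : Matrix (Fin n) (Fin n) ℝ)
                P.invertible, map_app' := fun x => ?_ }⟩
    change QuadraticMap.weightedSumSquares ℝ d ((P : Matrix (Fin n) (Fin n) ℝ) *ᵥ x) = _
    rw [hq, hq, ← h, dotProduct_comm, ← dotProduct_transpose_mulVec, mulVec_mulVec, mulVec_mulVec,
      dotProduct_comm, Matrix.mul_assoc]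
  rw [← QuadraticForm.sigNeg_weightedSumSquares, ← QuadraticForm.sigNeg_weightedSumSquares,
    ← QuadraticForm.sigPos_weightedSumSquares, ← QuadraticForm.sigPos_weightedSumSquares]
  exact ⟨hE.sigNeg_eq, hE.sigPos_eq⟩

theorem exists_orthogonal_diagonalization {M : Matrix (Fin n) (Fin n) ℝ} (hM : Mᵀ = M) :
    ∃ (k : Matrix (Fin n) (Fin n) ℝ) (ev : Fin n → ℝ), k ∈ orthogonalGroup (Fin n) ℝ ∧
      kᵀ * M * k = diagonal ev := by
  have hH : M.IsHermitian := by rwa [IsHermitian, conjTranspose_eq_transpose_of_trivial]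
  refine ⟨hH.eigenvectorUnitary, hH.eigenvalues, hH.eigenvectorUnitary.2, ?_⟩
  have := hH.conjStarAlgAut_star_eigenvectorUnitary
  rw [Unitary.conjStarAlgAut_star_apply] at this
  simpa [star_eq_conjTranspose, conjTranspose_eq_transpose_of_trivial] using this

theorem exists_tendsto_of_eventually_mem_Icc (U : Ultrafilter ℕ) {f : ℕ → ℝ} {a b : ℝ}
    (hf : ∀ᶠ j in (U : Filter ℕ), f j ∈ Set.Icc a b) :
    ∃ x ∈ Set.Icc a b, Tendsto f U (𝓝 x) := by
  obtain ⟨x, hx, hle⟩ := (isCompact_Icc (a := a) (b := b)).ultrafilter_le_nhds (U.map f)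
    (le_principal_iff.2 hf)
  exact ⟨x, hx, hle⟩

/-- A total preorder on `Fin n` is induced by a surjection onto some `Fin m`. -/
theorem exists_rank_of_total_preorder (R : Fin n → Fin n → Prop) (hrefl : ∀ a, R a a)
    (htrans : ∀ a b c, R a b → R b c → R a c) (htotal : ∀ a b, R a b ∨ R b a) :
    ∃ (m : ℕ) (w : Fin n → Fin m), Function.Surjective w ∧ ∀ a b, w a ≤ w b ↔ R a b := by
  classical
  -- `f a` counts the elements strictly below `a`
  set f : Fin n → ℕ := fun a => (Finset.univ.filter fun x => ¬ R a x).card with hf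
  have hle : ∀ a b, R a b → f a ≤ f b := fun a b hab => by
    refine Finset.card_le_card fun x hx => ?_
    simp only [Finset.mem_filter_univ] at hx ⊢
    exact fun h => hx (htrans _ _ _ hab h)
  have hlt : ∀ a b, ¬ R a b → f b < f a := fun a b hab => by
    refine Finset.card_lt_card ((Finset.ssubset_iff_of_subset fun x hx => ?_).2
      ⟨b, by simpa using hab, by simpa using hrefl b⟩)
    simp only [Finset.mem_filter_univ] at hx ⊢
    exact fun h => hx (htrans _ _ _ ((htotal a b).resolve_left hab) h)
  have hiff : ∀ a b, f a ≤ f b ↔ R a b := fun a b =>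
    ⟨fun h => by_contra fun hab => (hlt a b hab).not_ge h, hle a b⟩
  set S := Finset.univ.image f with hS
  let φ := S.orderIsoOfFin rfl
  have hmem : ∀ a, f a ∈ S := fun a => Finset.mem_image_of_mem _ (Finset.mem_univ a)
  refine ⟨S.card, fun a => φ.symm ⟨f a, hmem a⟩, fun i => ?_, fun a b => ?_⟩
  · obtain ⟨a, -, ha⟩ := Finset.mem_image.1 (φ i).2
    exact ⟨a, by simp [ha]⟩
  · rw [φ.symm.le_iff_le, Subtype.mk_le_mk, hiff]

/-- Along an ultrafilter, finitely many positive sequences fall into classes of comparable size;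
`s j i` is the size of a representative of the class `i`, and classes are listed by decreasing
size. -/
theorem exists_size_classes (U : Ultrafilter ℕ) {v : ℕ → Fin n → ℝ} (hv : ∀ j a, 0 < v j a) :
    ∃ (m : ℕ) (w : Fin n → Fin m) (s : ℕ → Fin m → ℝ) (e : Fin n → ℝ), Function.Surjective w ∧
      (∀ j i, 0 < s j i) ∧
      (∀ i i', i < i' → Tendsto (fun j => s j i' / s j i) U (𝓝 0)) ∧
      (∀ a, 0 < e a) ∧ ∀ a, Tendsto (fun j => v j a / s j (w a)) U (𝓝 (e a)) := by
  obtain ⟨m, w, hw, hR⟩ := exists_rank_of_total_preorder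
    (fun a b => ∃ C : ℝ, ∀ᶠ j in (U : Filter ℕ), v j b ≤ C * v j a)
    (fun a => ⟨1, Eventually.of_forall fun j => by simp⟩)
    (fun a b c => by
      rintro ⟨C, hC⟩ ⟨C', hC'⟩
      refine ⟨|C'| * C, ?_⟩
      filter_upwards [hC, hC'] with j h1 h2
      calc v j c ≤ C' * v j b := h2
        _ ≤ |C'| * v j b := by gcongr; exacts [(hv j b).le, le_abs_self _]
        _ ≤ |C'| * (C * v j a) := by gcongr
        _ = _ := by ring)
    (fun a b => by
      rcases U.em (fun j => v j b ≤ v j a) with h | h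
      · exact Or.inl ⟨1, by simpa using h⟩
      · refine Or.inr ⟨1, h.mono fun j hj => ?_⟩
        rw [one_mul]
        exact (not_le.1 hj).le)
  choose r hr using hw
  have hclass : ∀ a, ∃ x, 0 < x ∧ Tendsto (fun j => v j a / v j (r (w a))) U (𝓝 x) := by
    intro a
    obtain ⟨C, hC⟩ := (hR (r (w a)) a).1 (hr _).le
    obtain ⟨C', hC'⟩ := (hR a (r (w a))).1 (hr _).ge
    have hpos : 0 < C' := by
      obtain ⟨j, hj⟩ := hC'.exists
      exact pos_of_mul_pos_left ((hv j _).trans_le hj) (hv j a).le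
    obtain ⟨x, hx, hlim⟩ := exists_tendsto_of_eventually_mem_Icc U
      (f := fun j => v j a / v j (r (w a))) (a := C'⁻¹) (b := C) (by
        filter_upwards [hC, hC'] with j h1 h2
        have := hv j (r (w a))
        refine ⟨?_, (div_le_iff₀ this).2 h1⟩
        rw [le_div_iff₀ this, inv_mul_le_iff₀ hpos]
        exact h2)
    exact ⟨x, (inv_pos.2 hpos).trans_le hx.1, hlim⟩
  choose e he hlim using hclass
  refine ⟨m, w, fun j i => v j (r i), e, fun i => ⟨r i, hr i⟩, fun j i => hv j _, ?_, he, hlim⟩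
  intro i i' hii'
  have hn : ¬ ∃ C : ℝ, ∀ᶠ j in (U : Filter ℕ), v j (r i) ≤ C * v j (r i') := by
    rw [← hR, hr, hr]
    exact hii'.not_ge
  push Not at hn
  refine tendsto_order.2 ⟨fun x hx => Eventually.of_forall fun j =>
    hx.trans (div_pos (hv j _) (hv j _)), fun x hx => ?_⟩
  filter_upwards [hn x⁻¹] with j hj
  rw [div_lt_iff₀ (hv j _), ← inv_mul_lt_iff₀ hx]
  exact hj

theorem transpose_congruent_diagonal (c : GL (Fin n) ℝ) (d : Fin n → ℝ) :
    (((c⁻¹ : GL (Fin n) ℝ) : Matrix (Fin n) (Fin n) ℝ)ᵀ * diagonal d *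
      ((c⁻¹ : GL (Fin n) ℝ) : Matrix (Fin n) (Fin n) ℝ))ᵀ =
    ((c⁻¹ : GL (Fin n) ℝ) : Matrix (Fin n) (Fin n) ℝ)ᵀ * diagonal d *
      ((c⁻¹ : GL (Fin n) ℝ) : Matrix (Fin n) (Fin n) ℝ) := by
  simp only [transpose_mul, transpose_transpose, diagonal_transpose, Matrix.mul_assoc]

/-- Along an ultrafilter, the conjugates of the isometry group of a nondegenerate diagonal form
always converge to a conjugate of a group of block triangular isometries, the signs of which are
those of the form. The orthogonal matrices diagonalising the conjugated forms converge by
compactness, and the classes are those of eigenvalues of comparable size. -/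
theorem exists_isBlockIsometry_iff_mem_limitSet (U : Ultrafilter ℕ) {δ : Fin n → ℝ}
    (hδ : ∀ a, δ a ≠ 0) (c : ℕ → GL (Fin n) ℝ) :
    ∃ (m : ℕ) (w : Fin n → Fin m) (ε : Fin n → ℝ) (u : GL (Fin n) ℝ), Function.Surjective w ∧
      (∀ a, ε a = -1 ∨ ε a = 1) ∧
      {a | ε a < 0}.ncard = {a | δ a < 0}.ncard ∧ {a | 0 < ε a}.ncard = {a | 0 < δ a}.ncard ∧
      ∀ g, g ∈ limitSet (U : Filter ℕ) (fun j => {g | (c j)⁻¹ * g * c j ∈ isometries (diagonal δ)})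
        ↔ IsBlockIsometry w ε ((u⁻¹ * g * u : GL (Fin n) ℝ) : Matrix (Fin n) (Fin n) ℝ) := by
  choose k ev hk hdiag using fun j =>
    exists_orthogonal_diagonalization (transpose_congruent_diagonal (c j) δ)
  have hk1 : ∀ j, k j * (k j)ᵀ = 1 := fun j => (mem_orthogonalGroup_iff _ _).1 (hk j)
  have hk2 : ∀ j, (k j)ᵀ * k j = 1 := fun j => (mem_orthogonalGroup_iff' _ _).1 (hk j)
  let kGL : ℕ → GL (Fin n) ℝ := fun j => ⟨k j, (k j)ᵀ, hk1 j, hk2 j⟩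
  have hP : ∀ j, (((c j)⁻¹ * kGL j : GL (Fin n) ℝ) : Matrix (Fin n) (Fin n) ℝ)ᵀ * diagonal δ *
      ((c j)⁻¹ * kGL j : GL (Fin n) ℝ) = diagonal (ev j) := fun j => by
    rw [← hdiag j, Units.val_mul, transpose_mul]
    simp only [Matrix.mul_assoc]
    rfl
  have hev : ∀ j a, ev j a ≠ 0 := fun j => by
    have h1 := congrArg Matrix.det (hP j)
    rw [det_mul, det_mul, det_transpose, det_diagonal, det_diagonal] at h1
    have h2 : (((c j)⁻¹ * kGL j : GL (Fin n) ℝ) : Matrix (Fin n) (Fin n) ℝ).det ≠ 0 :=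
      (GeneralLinearGroup.det ((c j)⁻¹ * kGL j)).ne_zero
    have h3 : ∏ a, ev j a ≠ 0 := by
      rw [← h1]
      exact mul_ne_zero (mul_ne_zero h2 (Finset.prod_ne_zero_iff.2 fun a _ => hδ a)) h2
    exact fun a => Finset.prod_ne_zero_iff.1 h3 a (Finset.mem_univ a)
  -- the signs of the eigenvalues are eventually constant
  have hsign : ∀ a, ∃ x : ℝ, (x = -1 ∨ x = 1) ∧
      ∀ᶠ j in (U : Filter ℕ), ev j a = x * |ev j a| := fun a => by
    rcases U.em (fun j => 0 < ev j a) with h | h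
    · exact ⟨1, Or.inr rfl, h.mono fun j hj => by rw [abs_of_pos hj, one_mul]⟩
    · refine ⟨-1, Or.inl rfl, h.mono fun j hj => ?_⟩
      rw [abs_of_nonpos (not_lt.1 hj)]
      ring
  choose ε hε hεev using hsign
  have hall : ∀ᶠ j in (U : Filter ℕ), ∀ a, ev j a = ε a * |ev j a| := eventually_all.2 hεev
  have hcount : {a | ε a < 0}.ncard = {a | δ a < 0}.ncard ∧
      {a | 0 < ε a}.ncard = {a | 0 < δ a}.ncard := by
    obtain ⟨j, hj⟩ := hall.exists
    have h1 := ncard_eq_of_congruent (hP j)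
    rw [← h1.1, ← h1.2]
    have hpos : ∀ a, 0 < |ev j a| := fun a => abs_pos.2 (hev j a)
    constructor <;> congr 1 <;> ext a <;> simp only [Set.mem_ofPred_eq] <;> rw [hj a]
    · exact ⟨fun h => mul_neg_of_neg_of_pos h (hpos a), fun h => neg_of_mul_neg_left h (hpos a).le⟩
    · exact (mul_pos_iff_of_pos_right (hpos a)).symm
  -- the diagonalising orthogonal matrices converge
  have hentry : ∀ a b, ∃ x, Tendsto (fun j => k j a b) U (𝓝 x) := fun a b => by
    obtain ⟨x, -, hx⟩ := exists_tendsto_of_eventually_mem_Icc U (f := fun j => k j a b)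
      (a := -1) (b := 1) (Eventually.of_forall fun j => by
        have := entry_norm_bound_of_unitary (hk j) a b
        rwa [Real.norm_eq_abs, abs_le] at this)
    exact ⟨x, hx⟩
  choose K hKe using hentry
  have hK : Tendsto k U (𝓝 (of K)) := tendsto_pi_nhds.2 fun a => tendsto_pi_nhds.2 fun b => hKe a b
  have hKT : Tendsto (fun j => (k j)ᵀ) U (𝓝 (of K)ᵀ) :=
    (continuous_id.matrix_transpose.tendsto _).comp hK
  have hKK : of K * (of K)ᵀ = 1 := tendsto_nhds_unique (hK.mul hKT) (by simp [hk1])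
  have hKK' : (of K)ᵀ * of K = 1 := tendsto_nhds_unique (hKT.mul hK) (by simp [hk2])
  let KGL : GL (Fin n) ℝ := ⟨of K, (of K)ᵀ, hKK, hKK'⟩
  have hkK : Tendsto kGL U (𝓝 KGL) := tendsto_GL_iff.2 hK
  -- rescale the eigenvectors so that eigenvalues of comparable size become equal
  obtain ⟨m, w, s, e, hw, hs, hlim, he, hve⟩ := exists_size_classes U
    (v := fun j a => |ev j a|) (fun j a => abs_pos.2 (hev j a))
  have hdiagGL : ∀ f : Fin n → ℝ, (∀ a, 0 < f a) →
      ∃ D : GL (Fin n) ℝ, (D : Matrix (Fin n) (Fin n) ℝ) = diagonal fun a => (√(f a))⁻¹ := by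
    intro f hf
    refine ⟨GeneralLinearGroup.mkOfDetNeZero (diagonal fun a => (√(f a))⁻¹) ?_, rfl⟩
    rw [det_diagonal]
    exact Finset.prod_ne_zero_iff.2 fun a _ => inv_ne_zero (Real.sqrt_pos.2 (hf a)).ne'
  choose! diagInv hdiagInv using hdiagGL
  have hepos : ∀ j a, 0 < |ev j a| / s j (w a) := fun j a =>
    div_pos (abs_pos.2 (hev j a)) (hs j _)
  set D : ℕ → GL (Fin n) ℝ := fun j => diagInv fun a => |ev j a| / s j (w a) with hD
  have hDlim : Tendsto D U (𝓝 (diagInv e)) := by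
    rw [tendsto_GL_iff]
    simp only [hD, hdiagInv _ (hepos _), hdiagInv _ he]
    refine (continuous_id.matrix_diagonal.tendsto _).comp (tendsto_pi_nhds.2 fun a => ?_)
    exact (hve a).sqrt.inv₀ (Real.sqrt_pos.2 (he a)).ne'
  have hε0 : ∀ a, ε a ≠ 0 := fun a => by rcases hε a with h | h <;> rw [h] <;> norm_num
  refine ⟨m, w, ε, KGL * diagInv e, hw, hε, hcount.1, hcount.2, fun g => ?_⟩
  rw [← mem_limitSet_scaledForm_iff hε0 hs hlim]
  refine mem_limitSet_conj (u := fun j => kGL j * D j) (hkK.mul hDlim) ?_ g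
  filter_upwards [hall] with j hj g
  have hform : (((c j)⁻¹ * (kGL j * D j) : GL (Fin n) ℝ) : Matrix (Fin n) (Fin n) ℝ)ᵀ *
      diagonal δ * ((c j)⁻¹ * (kGL j * D j) : GL (Fin n) ℝ) = scaledForm w ε (s j) := by
    rw [← mul_assoc, Units.val_mul, transpose_mul]
    calc _ = (D j : Matrix (Fin n) (Fin n) ℝ)ᵀ *
          ((((c j)⁻¹ * kGL j : GL (Fin n) ℝ) : Matrix (Fin n) (Fin n) ℝ)ᵀ * diagonal δ *
          ((c j)⁻¹ * kGL j : GL (Fin n) ℝ)) * D j := by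
          simp only [Matrix.mul_assoc]
      _ = scaledForm w ε (s j) := by
          rw [hP, hD, hdiagInv _ (hepos j), diagonal_transpose, diagonal_mul_diagonal,
            diagonal_mul_diagonal, scaledForm]
          congr 1
          ext a
          have h1 := Real.mul_self_sqrt (hepos j a).le
          have h2 := (Real.sqrt_pos.2 (hepos j a)).ne'
          have h3 := (abs_pos.2 (hev j a)).ne'
          have h4 := (hs j (w a)).ne'
          calc _ = ev j a * (√(|ev j a| / s j (w a)) * √(|ev j a| / s j (w a)))⁻¹ := by
                rw [mul_inv]
                ring
            _ = ε a * |ev j a| * (|ev j a| / s j (w a))⁻¹ := by rw [h1, ← hj a]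
            _ = ε a * s j (w a) := by field_simp
  rw [SetLike.mem_coe]
  refine (mem_isometries_conj hform _).trans ?_
  have : ((c j)⁻¹ * (kGL j * D j))⁻¹ * ((c j)⁻¹ * g * c j) * ((c j)⁻¹ * (kGL j * D j)) =
      (kGL j * D j)⁻¹ * g * (kGL j * D j) := by group
  rw [this]

end Degeneration

/-! ### Coordinates adapted to a flag of forms -/

section Adapted

variable {n m : ℕ}

/-- The coordinates `u⁻¹ y` are adapted to the flag: the subspace `Vᵢ` is where the coordinates of
class less than `i` vanish. -/
def PartialFlag.IsAdapted (F : PartialFlag n m) (u : GL (Fin n) ℝ) (w : Fin n → Fin m) : Prop :=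
  ∀ i y, y ∈ F.space i ↔
    ∀ a, (w a).castSucc < i → (((u⁻¹ : GL (Fin n) ℝ) : Matrix (Fin n) (Fin n) ℝ) *ᵥ y) a = 0

/-- The coordinates `u⁻¹ y` are adapted to the flag of forms: they are adapted to the flag, and
`βᵢ` is the diagonal form with coefficients `ε` in the coordinates of class `i`. -/
structure FlagOfForms.IsAdapted {F : PartialFlag n m} (β : FlagOfForms F) (u : GL (Fin n) ℝ)
    (w : Fin n → Fin m) (ε : Fin n → ℝ) : Prop where
  flag : F.IsAdapted u w
  form_mk : ∀ i (y : F.space i.castSucc), β.form i (Submodule.Quotient.mk y) =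
    ∑ a with w a = i,
      ε a * (((u⁻¹ : GL (Fin n) ℝ) : Matrix (Fin n) (Fin n) ℝ) *ᵥ (y : Fin n → ℝ)) a ^ 2

theorem mulVec_apply_eq_sum (k : Matrix (Fin n) (Fin n) ℝ) (x : Fin n → ℝ) (c : Fin n) :
    (k *ᵥ x) c = ∑ a, k c a * x a := rfl

theorem inv_mulVec_mulVec (u : GL (Fin n) ℝ) (x : Fin n → ℝ) :
    ((u⁻¹ : GL (Fin n) ℝ) : Matrix (Fin n) (Fin n) ℝ) *ᵥ
      ((u : Matrix (Fin n) (Fin n) ℝ) *ᵥ x) = x := by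
  rw [mulVec_mulVec, Units.inv_mul, one_mulVec]

theorem mulVec_inv_mulVec (u : GL (Fin n) ℝ) (x : Fin n → ℝ) :
    (u : Matrix (Fin n) (Fin n) ℝ) *ᵥ
      (((u⁻¹ : GL (Fin n) ℝ) : Matrix (Fin n) (Fin n) ℝ) *ᵥ x) = x := by
  rw [mulVec_mulVec, Units.mul_inv, one_mulVec]

namespace PartialFlag

variable {F : PartialFlag n m} {u : GL (Fin n) ℝ} {w : Fin n → Fin m}

theorem IsAdapted.mulVec_mem_iff (h : F.IsAdapted u w) (i : Fin (m + 1)) (x : Fin n → ℝ) :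
    (u : Matrix (Fin n) (Fin n) ℝ) *ᵥ x ∈ F.space i ↔ ∀ a, (w a).castSucc < i → x a = 0 := by
  rw [h, inv_mulVec_mulVec]

/-- The coordinates of class `i`, as a linear map on `Vᵢ`. -/
def coordMap (F : PartialFlag n m) (u : GL (Fin n) ℝ) (w : Fin n → Fin m) (i : Fin m) :
    F.space i.castSucc →ₗ[ℝ] ({a // w a = i} → ℝ) :=
  LinearMap.funLeft ℝ ℝ Subtype.val ∘ₗ
    ((u⁻¹ : GL (Fin n) ℝ) : Matrix (Fin n) (Fin n) ℝ).mulVecLin ∘ₗ (F.space i.castSucc).subtype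

theorem coordMap_apply (i : Fin m) (y : F.space i.castSucc) (a : {a // w a = i}) :
    F.coordMap u w i y a =
      (((u⁻¹ : GL (Fin n) ℝ) : Matrix (Fin n) (Fin n) ℝ) *ᵥ (y : Fin n → ℝ)) a := rfl

theorem IsAdapted.ker_coordMap (h : F.IsAdapted u w) (i : Fin m) :
    LinearMap.ker (F.coordMap u w i) = (F.space i.succ).submoduleOf (F.space i.castSucc) := by
  ext y
  rw [LinearMap.mem_ker, Submodule.submoduleOf, Submodule.mem_comap, Submodule.subtype_apply, h]
  constructor
  · intro hy a ha
    rcases (Fin.castSucc_lt_succ_iff.1 ha).lt_or_eq with hlt | heq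
    · exact (h _ _).1 y.2 a (Fin.castSucc_lt_castSucc_iff.2 hlt)
    · exact congrFun hy ⟨a, heq⟩
  · intro hy
    ext ⟨a, ha⟩
    exact hy a (by rw [ha]; exact Fin.castSucc_lt_succ)

theorem IsAdapted.coordMap_surjective (h : F.IsAdapted u w) (i : Fin m) :
    Function.Surjective (F.coordMap u w i) := by
  intro x
  classical
  let x' : Fin n → ℝ := fun a => if ha : w a = i then x ⟨a, ha⟩ else 0
  refine ⟨⟨(u : Matrix (Fin n) (Fin n) ℝ) *ᵥ x', (h.mulVec_mem_iff _ _).2 fun a ha => ?_⟩, ?_⟩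
  · exact dif_neg (Fin.castSucc_lt_castSucc_iff.1 ha).ne
  · ext ⟨a, ha⟩
    rw [coordMap_apply]
    simp [x', ha]

/-- The coordinates of class `i` identify `Vᵢ / Vᵢ₊₁` with a coordinate space. -/
noncomputable def IsAdapted.quotEquiv (h : F.IsAdapted u w) (i : Fin m) :
    F.Quot i ≃ₗ[ℝ] ({a // w a = i} → ℝ) :=
  Submodule.quotEquivOfEq _ _ (h.ker_coordMap i).symm ≪≫ₗ
    (F.coordMap u w i).quotKerEquivOfSurjective (h.coordMap_surjective i)

theorem IsAdapted.quotEquiv_mk (h : F.IsAdapted u w) (i : Fin m) (y : F.space i.castSucc) :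
    h.quotEquiv i (Submodule.Quotient.mk y) = F.coordMap u w i y := rfl

end PartialFlag

theorem sum_filter_eq_sum_subtype (w : Fin n → Fin m) (i : Fin m) (f : Fin n → ℝ) :
    ∑ a with w a = i, f a = ∑ a : {a // w a = i}, f a :=
  Finset.sum_subtype _ (by simp) _

namespace FlagOfForms

variable {F : PartialFlag n m} {β : FlagOfForms F} {u : GL (Fin n) ℝ} {w : Fin n → Fin m}
  {ε : Fin n → ℝ}

theorem IsAdapted.equivalent (h : β.IsAdapted u w ε) (i : Fin m) :
    (β.form i).Equivalent
      (QuadraticMap.weightedSumSquares ℝ fun a : {a // w a = i} => ε a) := by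
  refine ⟨{ toLinearEquiv := h.flag.quotEquiv i, map_app' := fun x => ?_ }⟩
  induction x using Submodule.Quotient.induction_on with
  | _ y =>
  rw [h.form_mk, sum_filter_eq_sum_subtype]
  change QuadraticMap.weightedSumSquares ℝ _ (h.flag.quotEquiv i (Submodule.Quotient.mk y)) = _
  rw [h.flag.quotEquiv_mk, QuadraticMap.weightedSumSquares_apply]
  refine Finset.sum_congr rfl fun a _ => ?_
  rw [PartialFlag.coordMap_apply, smul_eq_mul, sq]

theorem IsAdapted.signature_eq (h : β.IsAdapted u w ε) (i : Fin m) :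
    β.signature i = ((Finset.univ.filter fun a => w a = i ∧ ε a < 0).card,
      (Finset.univ.filter fun a => w a = i ∧ 0 < ε a).card) := by
  have key : ∀ p : Fin n → Prop, {a : {a // w a = i} | p a}.ncard =
      {a : Fin n | w a = i ∧ p a}.ncard := fun p => by
    rw [← Set.ncard_image_of_injective _ Subtype.val_injective]
    congr 1
    ext a
    simp [and_comm]
  have key' : ∀ (p : Fin n → Prop) [DecidablePred p], {a : Fin n | w a = i ∧ p a}.ncard =
      (Finset.univ.filter fun a => w a = i ∧ p a).card := fun p _ => by
    rw [← Set.ncard_coe_finset]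
    simp
  rw [signature, QuadraticForm.sigNeg_of_equiv_weightedSumSquares (h.equivalent i),
    QuadraticForm.sigPos_of_equiv_weightedSumSquares (h.equivalent i), key (fun a => ε a < 0),
    key (fun a => 0 < ε a), key', key']

/-- In adapted coordinates, `Isom(β, F)` is the group of block triangular isometries. -/
theorem IsAdapted.mem_isom_iff (h : β.IsAdapted u w ε) (g : GL (Fin n) ℝ) :
    g ∈ β.isom ↔
      IsBlockIsometry w ε ((u⁻¹ * g * u : GL (Fin n) ℝ) : Matrix (Fin n) (Fin n) ℝ) := by
  have hmul : ∀ (g : GL (Fin n) ℝ) (x : Fin n → ℝ), ((u⁻¹ * g * u : GL (Fin n) ℝ) :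
      Matrix (Fin n) (Fin n) ℝ) *ᵥ x = ((u⁻¹ : GL (Fin n) ℝ) : Matrix (Fin n) (Fin n) ℝ) *ᵥ
        ((g : Matrix (Fin n) (Fin n) ℝ) *ᵥ ((u : Matrix (Fin n) (Fin n) ℝ) *ᵥ x)) := fun g x => by
    simp only [Units.val_mul, mulVec_mulVec, Matrix.mul_assoc]
  have hsingle : ∀ a (c : Fin n), (w c).castSucc < (w a).castSucc →
      (Pi.single a 1 : Fin n → ℝ) c = 0 := fun a c hc =>
    Pi.single_eq_of_ne (fun hca => by simp [hca] at hc) _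
  constructor
  · rintro ⟨hpres, hform⟩
    have htri : ∀ a b, w b < w a → (u⁻¹ * g * u : GL (Fin n) ℝ) b a = 0 := by
      intro a b hab
      have h1 : (u : Matrix (Fin n) (Fin n) ℝ) *ᵥ Pi.single a 1 ∈ F.space (w a).castSucc :=
        (h.flag.mulVec_mem_iff _ _).2 (hsingle a)
      have h2 := (h.flag _ _).1 (hpres.mem _ _ h1) b (Fin.castSucc_lt_castSucc_iff.2 hab)
      rw [mulVecLin_apply, ← hmul, mulVec_single_one] at h2
      exact h2
    refine ⟨blockTriangular_toDual_iff.2 htri, fun a b hab => ?_⟩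
    have hval : ∀ x : Fin n → ℝ, (∀ c, (w c).castSucc < (w a).castSucc → x c = 0) →
        ∑ c with w c = w a, ε c * (((u⁻¹ * g * u : GL (Fin n) ℝ) :
          Matrix (Fin n) (Fin n) ℝ) *ᵥ x) c ^ 2 = ∑ c with w c = w a, ε c * x c ^ 2 := by
      intro x hx
      have h1 := (h.flag.mulVec_mem_iff _ _).2 hx
      have h2 := hform (w a) (Submodule.Quotient.mk ⟨_, h1⟩)
      rw [h.form_mk] at h2
      have h3 : hpres.quotMap (w a) (Submodule.Quotient.mk ⟨_, h1⟩) =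
          Submodule.Quotient.mk ⟨_, hpres.mem _ _ h1⟩ := rfl
      rw [h3, h.form_mk] at h2
      simpa only [hmul, inv_mulVec_mulVec, mulVecLin_apply] using h2
    have hones : ∀ b, w b = w a → ∑ c with w c = w a, ε c * (Pi.single b 1 : Fin n → ℝ) c ^ 2 =
        ε b := fun b hb => by
      rw [Finset.sum_eq_single b]
      · simp
      · intro c _ hc
        simp [hc]
      · simp [hb]
    have hsq : ∀ b, w b = w a →
        ∑ c with w c = w a, ε c * ((u⁻¹ * g * u : GL (Fin n) ℝ) c b) ^ 2 = ε b := fun b hb => by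
      have := hval (Pi.single b 1) (hb ▸ hsingle b)
      rw [hones b hb, mulVec_single_one] at this
      exact this
    by_cases hne : a = b
    · subst hne
      rw [if_pos rfl, ← hsq a rfl]
      exact Finset.sum_congr rfl fun c _ => by ring
    · rw [if_neg hne]
      have h1 := hval (Pi.single a 1 + Pi.single b 1) fun c hc => by
        rw [Pi.add_apply, hsingle a c hc, hsingle b c (by rwa [← hab]), add_zero]
      rw [mulVec_add, mulVec_single_one, mulVec_single_one] at h1
      have h2 : ∑ c with w c = w a,
          ε c * (Pi.single a 1 + Pi.single b 1 : Fin n → ℝ) c ^ 2 = ε a + ε b := by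
        rw [← hones a rfl, ← hones b hab.symm, ← Finset.sum_add_distrib]
        refine Finset.sum_congr rfl fun c _ => ?_
        rw [Pi.add_apply]
        by_cases hca : c = a
        · subst hca; simp [hne]
        · simp [hca]
      rw [h2] at h1
      have h3 : ∑ c with w c = w a, ε c * (((u⁻¹ * g * u : GL (Fin n) ℝ) c a) +
          ((u⁻¹ * g * u : GL (Fin n) ℝ) c b)) ^ 2 = ε a + ε b := h1
      have h4 : ∀ c, ε c * (((u⁻¹ * g * u : GL (Fin n) ℝ) c a) +
          ((u⁻¹ * g * u : GL (Fin n) ℝ) c b)) ^ 2 = ε c * ((u⁻¹ * g * u : GL (Fin n) ℝ) c a) ^ 2 +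
          ε c * ((u⁻¹ * g * u : GL (Fin n) ℝ) c b) ^ 2 + 2 * (ε c *
          ((u⁻¹ * g * u : GL (Fin n) ℝ) c a * (u⁻¹ * g * u : GL (Fin n) ℝ) c b)) :=
        fun c => by ring
      simp only [h4, Finset.sum_add_distrib, ← Finset.mul_sum] at h3
      rw [hsq a rfl, hsq b hab.symm] at h3
      linarith
  · intro hB
    have hle : ∀ g : GL (Fin n) ℝ, ((u⁻¹ * g * u : GL (Fin n) ℝ) :
        Matrix (Fin n) (Fin n) ℝ).BlockTriangular (OrderDual.toDual ∘ w) → ∀ i,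
        (F.space i).map (g : Matrix (Fin n) (Fin n) ℝ).mulVecLin ≤ F.space i := by
      intro g hg i
      rw [Submodule.map_le_iff_le_comap]
      intro y hy
      rw [Submodule.mem_comap, mulVecLin_apply, h.flag]
      intro a ha
      rw [← mulVec_inv_mulVec u y, ← hmul]
      rw [mulVec_apply_eq_sum]
      refine Finset.sum_eq_zero fun b _ => ?_
      by_cases hb : (w b).castSucc < i
      · rw [(h.flag _ _).1 hy b hb, mul_zero]
      · rw [blockTriangular_toDual_iff.1 hg b a
          (Fin.castSucc_lt_castSucc_iff.1 (ha.trans_le (not_lt.1 hb))), zero_mul]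
    have hpres : F.IsPreservedBy g := by
      intro i
      refine le_antisymm (hle g hB.1 i) fun y hy => ?_
      have h1 : ((u⁻¹ * g⁻¹ * u : GL (Fin n) ℝ) :
          Matrix (Fin n) (Fin n) ℝ).BlockTriangular (OrderDual.toDual ∘ w) := by
        have : u⁻¹ * g⁻¹ * u = (u⁻¹ * g * u)⁻¹ := by group
        rw [this]
        exact blockTriangular_inv hB.1
      exact ⟨_, hle _ h1 i (Submodule.mem_map_of_mem hy), mulVec_inv_mulVec g y⟩
    refine ⟨hpres, fun i x => ?_⟩
    induction x using Submodule.Quotient.induction_on with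
    | _ y =>
    have h3 : hpres.quotMap i (Submodule.Quotient.mk y) =
        Submodule.Quotient.mk ⟨_, hpres.mem _ _ y.2⟩ := rfl
    rw [h3, h.form_mk, h.form_mk]
    change ∑ a with w a = i, ε a * (((u⁻¹ : GL (Fin n) ℝ) : Matrix (Fin n) (Fin n) ℝ) *ᵥ
      ((g : Matrix (Fin n) (Fin n) ℝ) *ᵥ (y : Fin n → ℝ))) a ^ 2 = _
    set x := ((u⁻¹ : GL (Fin n) ℝ) : Matrix (Fin n) (Fin n) ℝ) *ᵥ (y : Fin n → ℝ) with hx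
    have hyx : (y : Fin n → ℝ) = (u : Matrix (Fin n) (Fin n) ℝ) *ᵥ x := (mulVec_inv_mulVec u _).symm
    have hx0 := (h.flag _ _).1 y.2
    rw [← hx] at hx0
    rw [hyx, ← hmul]
    set k := ((u⁻¹ * g * u : GL (Fin n) ℝ) : Matrix (Fin n) (Fin n) ℝ) with hk
    have hrow : ∀ c, w c = i → (k *ᵥ x) c = ∑ a with w a = i, k c a * x a := by
      intro c hc
      rw [mulVec_apply_eq_sum]
      refine (Finset.sum_filter_of_ne fun a _ hne => ?_).symm
      by_contra ha
      rcases lt_or_gt_of_ne ha with ha | ha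
      · exact hne (by rw [hx0 a (Fin.castSucc_lt_castSucc_iff.2 ha), mul_zero])
      · exact hne (by rw [blockTriangular_toDual_iff.1 hB.1 a c (hc ▸ ha), zero_mul])
    calc ∑ c with w c = i, ε c * (k *ᵥ x) c ^ 2
        = ∑ c with w c = i, ∑ a with w a = i, ∑ b with w b = i,
            x a * x b * (ε c * (k c a * k c b)) := by
          refine Finset.sum_congr rfl fun c hc => ?_
          rw [hrow c (Finset.mem_filter.1 hc).2, sq, Finset.sum_mul_sum, Finset.mul_sum]
          refine Finset.sum_congr rfl fun a _ => ?_
          rw [Finset.mul_sum]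
          exact Finset.sum_congr rfl fun b _ => by ring
      _ = ∑ a with w a = i, ∑ b with w b = i, x a * x b *
            ∑ c with w c = i, ε c * (k c a * k c b) := by
          rw [Finset.sum_comm]
          refine Finset.sum_congr rfl fun a _ => ?_
          rw [Finset.sum_comm]
          exact Finset.sum_congr rfl fun b _ => by rw [Finset.mul_sum]
      _ = ∑ a with w a = i, ∑ b with w b = i, x a * x b * if a = b then ε a else 0 := by
          refine Finset.sum_congr rfl fun a ha => Finset.sum_congr rfl fun b hb => ?_
          have ha' := (Finset.mem_filter.1 ha).2
          have := hB.block a b (ha'.trans (Finset.mem_filter.1 hb).2.symm)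
          rw [ha'] at this
          rw [this]
      _ = ∑ a with w a = i, ε a * x a ^ 2 := by
          refine Finset.sum_congr rfl fun a ha => ?_
          rw [Finset.sum_eq_single a]
          · rw [if_pos rfl]
            ring
          · intro b _ hb
            rw [if_neg hb.symm, mul_zero]
          · exact fun h => absurd ha h

end FlagOfForms

/-- Any coordinates, sorted into classes by a surjection, are adapted to some flag. -/
theorem exists_flag_isAdapted (u : GL (Fin n) ℝ) {w : Fin n → Fin m} (hw : Function.Surjective w) :
    ∃ F : PartialFlag n m, F.IsAdapted u w := by
  let V : Fin (m + 1) → Submodule ℝ (Fin n → ℝ) := fun i =>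
    { carrier := {y | ∀ a, (w a).castSucc < i →
        (((u⁻¹ : GL (Fin n) ℝ) : Matrix (Fin n) (Fin n) ℝ) *ᵥ y) a = 0}
      add_mem' := fun {x y} hx hy a ha => by rw [mulVec_add, Pi.add_apply, hx a ha, hy a ha, add_zero]
      zero_mem' := fun a _ => by simp
      smul_mem' := fun c x hx a ha => by rw [mulVec_smul, Pi.smul_apply, hx a ha, smul_zero] }
  have hV : ∀ i y, y ∈ V i ↔ ∀ a, (w a).castSucc < i →
      (((u⁻¹ : GL (Fin n) ℝ) : Matrix (Fin n) (Fin n) ℝ) *ᵥ y) a = 0 := fun i y => Iff.rfl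
  refine ⟨⟨V, ?_, ?_, ?_⟩, hV⟩
  · refine Fin.strictAnti_iff_succ_lt.2 fun i => SetLike.lt_iff_le_and_exists.2 ⟨fun y hy a ha =>
      hy a (ha.trans Fin.castSucc_lt_succ), ?_⟩
    obtain ⟨a, rfl⟩ := hw i
    refine ⟨(u : Matrix (Fin n) (Fin n) ℝ) *ᵥ Pi.single a 1, fun b hb => ?_, fun hcon => ?_⟩
    · rw [inv_mulVec_mulVec]
      exact Pi.single_eq_of_ne (fun h => by simp [h] at hb) _
    · have := hcon a Fin.castSucc_lt_succ
      rw [inv_mulVec_mulVec, Pi.single_eq_same] at this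
      exact one_ne_zero this
  · rw [eq_top_iff]
    exact fun y _ a ha => absurd ha (Fin.not_lt_zero _)
  · rw [eq_bot_iff]
    intro y hy
    have : ((u⁻¹ : GL (Fin n) ℝ) : Matrix (Fin n) (Fin n) ℝ) *ᵥ y = 0 :=
      funext fun a => hy a (Fin.castSucc_lt_last _)
    rw [Submodule.mem_bot, ← mulVec_inv_mulVec u y, this, mulVec_zero]

theorem exists_flagOfForms_isAdapted (u : GL (Fin n) ℝ) {w : Fin n → Fin m}
    (hw : Function.Surjective w) {ε : Fin n → ℝ} (hε : ∀ a, ε a ≠ 0) :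
    ∃ (F : PartialFlag n m) (β : FlagOfForms F), β.IsAdapted u w ε := by
  obtain ⟨F, hF⟩ := exists_flag_isAdapted u hw
  have hnd : ∀ i, (QuadraticMap.weightedSumSquares ℝ fun a : {a // w a = i} => ε a).Nondegenerate :=
    fun i => by
      have : Invertible (2 : ℝ) := invertibleOfNonzero two_ne_zero
      rw [QuadraticMap.nondegenerate_iff_radical_eq_bot, QuadraticForm.radical_weightedSumSquares]
      simp [hε, Pi.spanSubset]
  refine ⟨F, ⟨fun i => (QuadraticMap.weightedSumSquares ℝ fun a : {a // w a = i} => ε a).comp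
    (hF.quotEquiv i).toLinearMap, fun i => ?_⟩, hF, fun i y => ?_⟩
  · have : Invertible (2 : ℝ) := invertibleOfNonzero two_ne_zero
    have e : QuadraticMap.IsometryEquiv ((QuadraticMap.weightedSumSquares ℝ
        fun a : {a // w a = i} => ε a).comp (hF.quotEquiv i).toLinearMap)
        (QuadraticMap.weightedSumSquares ℝ fun a : {a // w a = i} => ε a) :=
      { toLinearEquiv := hF.quotEquiv i, map_app' := fun x => rfl }
    rw [QuadraticMap.nondegenerate_iff_radical_eq_bot]
    have h1 := e.map_radical
    rw [(hnd i).radical_eq_bot] at h1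
    exact (Submodule.map_eq_bot_iff (e := e.toLinearEquiv)).1 h1
  · rw [sum_filter_eq_sum_subtype]
    change QuadraticMap.weightedSumSquares ℝ _ (hF.quotEquiv i (Submodule.Quotient.mk y)) = _
    rw [hF.quotEquiv_mk, QuadraticMap.weightedSumSquares_apply]
    refine Finset.sum_congr rfl fun a _ => ?_
    rw [PartialFlag.coordMap_apply, smul_eq_mul, sq]

end Adapted

/-! ### Existence of adapted coordinates -/

section AdaptedExists

variable {n m : ℕ}

theorem FlagOfForms.exists_diagonalization {F : PartialFlag n m} (β : FlagOfForms F) (i : Fin m) :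
    ∃ (d : ℕ) (ε : Fin d → ℝ) (φ : F.Quot i ≃ₗ[ℝ] (Fin d → ℝ)),
      (∀ k, ε k = -1 ∨ ε k = 1) ∧ ∀ x, β.form i x = ∑ k, ε k * φ x k ^ 2 := by
  obtain ⟨ε, hε, ⟨e⟩⟩ := (β.form i).equivalent_one_neg_one_weighted_sum_squared
    (QuadraticMap.nondegenerate_associated_iff.2 (β.nondegenerate i)).1
  refine ⟨_, ε, e.toLinearEquiv, hε, fun x => ?_⟩
  have := e.map_app x
  rw [QuadraticMap.weightedSumSquares_apply] at this
  rw [← this]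
  exact Finset.sum_congr rfl fun k _ => by rw [smul_eq_mul, sq]; rfl

/-- Lifts of bases of the successive quotients form a basis of the whole space; coordinates in
this basis are adapted to the flag. -/
theorem exists_isAdapted_of_quot_equiv (F : PartialFlag n m) {d : Fin m → ℕ}
    (φ : ∀ i, F.Quot i ≃ₗ[ℝ] (Fin (d i) → ℝ)) :
    ∃ (u : GL (Fin n) ℝ) (τ : Fin n ≃ Σ i, Fin (d i)), F.IsAdapted u (fun a => (τ a).1) ∧
      ∀ i (y : F.space i.castSucc) k, φ i (Submodule.Quotient.mk y) k =
        (((u⁻¹ : GL (Fin n) ℝ) : Matrix (Fin n) (Fin n) ℝ) *ᵥ (y : Fin n → ℝ)) (τ.symm ⟨i, k⟩) := by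
  classical
  have hanti := F.strictAnti.antitone
  have hlift : ∀ i (k : Fin (d i)), ∃ v : F.space i.castSucc,
      φ i (Submodule.Quotient.mk v) = Pi.single k 1 := fun i k => by
    obtain ⟨v, hv⟩ := Submodule.Quotient.mk_surjective _ ((φ i).symm (Pi.single k 1))
    exact ⟨v, by rw [hv, LinearEquiv.apply_symm_apply]⟩
  choose v hv using hlift
  let Φ : ((Σ i, Fin (d i)) → ℝ) →ₗ[ℝ] (Fin n → ℝ) :=
    Fintype.linearCombination ℝ fun s => (v s.1 s.2 : Fin n → ℝ)
  have hΦ : ∀ x, Φ x = ∑ i, ∑ k, x ⟨i, k⟩ • (v i k : Fin n → ℝ) := fun x => by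
    have : Φ x = ∑ s, x s • (v s.1 s.2 : Fin n → ℝ) := rfl
    rw [this, Fintype.sum_sigma]
  have hquot : ∀ i (x : Fin (d i) → ℝ),
      φ i (Submodule.Quotient.mk (∑ k, x k • v i k)) = x := fun i x => by
    have : (Submodule.Quotient.mk (∑ k, x k • v i k) : F.Quot i) =
        ∑ k, x k • (Submodule.Quotient.mk (v i k) : F.Quot i) := by
      simp only [← Submodule.mkQ_apply, map_sum, map_smul]
    rw [this, map_sum]
    simp only [map_smul, hv]
    ext k
    simp [Finset.sum_apply, Pi.single_apply]
  have hcong : ∀ i (y y' : F.space i.castSucc), (y : Fin n → ℝ) - y' ∈ F.space i.succ →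
      φ i (Submodule.Quotient.mk y) = φ i (Submodule.Quotient.mk y') := fun i y y' h => by
    congr 1
    exact (Submodule.Quotient.eq _).2 h
  -- modulo `Vᵢ₊₁`, only the coordinates of class `i` of an element of `Vᵢ` matter
  have hlead : ∀ i (x : (Σ i, Fin (d i)) → ℝ), (∀ s, s.1.castSucc < i.castSucc → x s = 0) →
      Φ x - ∑ k, x ⟨i, k⟩ • (v i k : Fin n → ℝ) ∈ F.space i.succ := by
    intro i x hx
    rw [hΦ, ← Finset.add_sum_erase _ _ (Finset.mem_univ i), add_sub_cancel_left]
    refine Submodule.sum_mem _ fun i' hi' => Submodule.sum_mem _ fun k _ => ?_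
    rcases lt_or_gt_of_ne (Finset.ne_of_mem_erase hi') with h | h
    · rw [hx ⟨i', k⟩ (Fin.castSucc_lt_castSucc_iff.2 h), zero_smul]
      exact zero_mem _
    · exact Submodule.smul_mem _ _ (hanti (Fin.succ_le_castSucc_iff.2 h) (v i' k).2)
  have hsub : ∀ i (x : Fin (d i) → ℝ), ((∑ k, x k • v i k : F.space i.castSucc) : Fin n → ℝ) =
      ∑ k, x k • (v i k : Fin n → ℝ) := fun i x => by simp
  have hφΦ : ∀ i (x : (Σ i, Fin (d i)) → ℝ), (∀ s, s.1.castSucc < i.castSucc → x s = 0) →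
      ∀ h : Φ x ∈ F.space i.castSucc,
      φ i (Submodule.Quotient.mk ⟨Φ x, h⟩) = fun k => x ⟨i, k⟩ := by
    intro i x hx h
    rw [← hquot i fun k => x ⟨i, k⟩]
    refine hcong _ _ _ ?_
    rw [hsub]
    exact hlead i x hx
  have hzero : ∀ (i : Fin (m + 1)) (x : (Σ i, Fin (d i)) → ℝ), Φ x ∈ F.space i →
      ∀ s, s.1.castSucc < i → x s = 0 := by
    intro i
    induction i using Fin.induction with
    | zero => exact fun x _ s hs => absurd hs (Fin.not_lt_zero _)
    | succ i ih =>
      rintro x hx ⟨i', k⟩ hs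
      have hx' := hanti (Fin.castSucc_lt_succ (i := i)).le hx
      have h0 := ih x hx'
      rcases (Fin.castSucc_lt_succ_iff.1 hs).lt_or_eq with hlt | heq
      · exact h0 _ (Fin.castSucc_lt_castSucc_iff.2 hlt)
      · subst heq
        have h1 := hφΦ _ x h0 hx'
        rw [hcong _ ⟨Φ x, hx'⟩ 0 (by simpa using hx), Submodule.Quotient.mk_zero, map_zero] at h1
        exact (congrFun h1 k).symm
  have hspan : ∀ (i : Fin (m + 1)) (y : Fin n → ℝ), y ∈ F.space i →
      ∃ x, Φ x = y ∧ ∀ s, s.1.castSucc < i → x s = 0 := by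
    intro i
    induction i using Fin.reverseInduction with
    | last =>
      intro y hy
      rw [F.space_last, Submodule.mem_bot] at hy
      exact ⟨0, by rw [map_zero, hy], fun _ _ => rfl⟩
    | cast i ih =>
      intro y hy
      set z := φ i (Submodule.Quotient.mk ⟨y, hy⟩) with hz
      have h1 : y - ∑ k, z k • (v i k : Fin n → ℝ) ∈ F.space i.succ := by
        have : (Submodule.Quotient.mk ⟨y, hy⟩ : F.Quot i) =
            Submodule.Quotient.mk (∑ k, z k • v i k) := by
          apply (φ i).injective
          rw [hquot]
        have := (Submodule.Quotient.eq _).1 this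
        rw [Submodule.submoduleOf, Submodule.mem_comap] at this
        simpa using this
      obtain ⟨x, hx, hx0⟩ := ih _ h1
      let z' : (Σ i, Fin (d i)) → ℝ := fun s => if h : s.1 = i then z (h ▸ s.2) else 0
      have hz' : Φ z' = ∑ k, z k • (v i k : Fin n → ℝ) := by
        rw [hΦ, Finset.sum_eq_single i]
        · simp [z']
        · intro i' _ hi'
          simp [z', hi']
        · simp
      refine ⟨x + z', by rw [map_add, hx, hz', sub_add_cancel], fun s hs => ?_⟩
      have hs' : s.1 < i := Fin.castSucc_lt_castSucc_iff.1 hs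
      rw [Pi.add_apply, hx0 s (hs.trans Fin.castSucc_lt_succ)]
      simp [z', hs'.ne]
  have hbij : Function.Bijective Φ := by
    constructor
    · rw [← LinearMap.ker_eq_bot, LinearMap.ker_eq_bot']
      intro x hx
      ext s
      exact hzero (Fin.last m) x (by rw [hx]; exact zero_mem _) s (Fin.castSucc_lt_last _)
    · intro y
      obtain ⟨x, hx, -⟩ := hspan 0 y (by rw [F.space_zero]; trivial)
      exact ⟨x, hx⟩
  let Ψ : ((Σ i, Fin (d i)) → ℝ) ≃ₗ[ℝ] (Fin n → ℝ) := LinearEquiv.ofBijective Φ hbij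
  have hcard : Fintype.card (Fin n) = Fintype.card (Σ i, Fin (d i)) := by
    have := Ψ.finrank_eq
    rw [Module.finrank_fintype_fun_eq_card, Module.finrank_fintype_fun_eq_card] at this
    exact this.symm
  let τ : Fin n ≃ Σ i, Fin (d i) := Fintype.equivOfCardEq hcard
  let f : (Fin n → ℝ) ≃ₗ[ℝ] (Fin n → ℝ) := (LinearEquiv.funCongrLeft ℝ ℝ τ.symm).trans Ψ
  let u : GL (Fin n) ℝ := ⟨LinearMap.toMatrix' f.toLinearMap, LinearMap.toMatrix' f.symm.toLinearMap,
    by rw [← LinearMap.toMatrix'_comp]; simp, by rw [← LinearMap.toMatrix'_comp]; simp⟩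
  have hu : ∀ y a, (((u⁻¹ : GL (Fin n) ℝ) : Matrix (Fin n) (Fin n) ℝ) *ᵥ y) a =
      Ψ.symm y (τ a) := fun y a => by
    have : ((u⁻¹ : GL (Fin n) ℝ) : Matrix (Fin n) (Fin n) ℝ) *ᵥ y = f.symm y := by
      change LinearMap.toMatrix' f.symm.toLinearMap *ᵥ y = _
      rw [LinearMap.toMatrix'_mulVec]
      rfl
    rw [this]
    rfl
  have hΨ : ∀ y, Φ (Ψ.symm y) = y := fun y => Ψ.apply_symm_apply y
  have hmem : ∀ i y, y ∈ F.space i ↔ ∀ s, s.1.castSucc < i → Ψ.symm y s = 0 := by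
    intro i y
    constructor
    · intro hy
      exact hzero i _ (by rwa [hΨ])
    · intro hy
      rw [← hΨ y, hΦ]
      refine Submodule.sum_mem _ fun i' _ => Submodule.sum_mem _ fun k _ => ?_
      by_cases h : i'.castSucc < i
      · rw [hy ⟨i', k⟩ h, zero_smul]
        exact zero_mem _
      · exact Submodule.smul_mem _ _ (hanti (not_lt.1 h) (v i' k).2)
  refine ⟨u, τ, fun i y => ?_, fun i y k => ?_⟩
  · rw [hmem]
    simp only [hu]
    exact τ.forall_congr_right.symm
  · rw [hu, Equiv.apply_symm_apply]
    have h1 := hφΦ i (Ψ.symm y) ((hmem _ _).1 y.2) (by rw [hΨ]; exact y.2)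
    have h2 : (⟨Φ (Ψ.symm y), by rw [hΨ]; exact y.2⟩ : F.space i.castSucc) = y :=
      Subtype.ext (hΨ y)
    rw [h2] at h1
    exact congrFun h1 k

/-- Every flag of forms has adapted coordinates, in which the forms have coefficients `±1`. -/
theorem FlagOfForms.exists_isAdapted {F : PartialFlag n m} (β : FlagOfForms F) :
    ∃ (u : GL (Fin n) ℝ) (w : Fin n → Fin m) (ε : Fin n → ℝ),
      (∀ a, ε a = -1 ∨ ε a = 1) ∧ β.IsAdapted u w ε := by
  choose d ε φ hε hφ using β.exists_diagonalization
  obtain ⟨u, τ, hF, hu⟩ := exists_isAdapted_of_quot_equiv F φ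
  obtain ⟨ε', hε'⟩ : ∃ ε' : (Σ i, Fin (d i)) → ℝ, ∀ i k, ε' ⟨i, k⟩ = ε i k :=
    ⟨fun s => ε s.1 s.2, fun _ _ => rfl⟩
  refine ⟨u, fun a => (τ a).1, fun a => ε' (τ a), fun a => ?_, hF, fun i y => ?_⟩
  · have := hε (τ a).1 (τ a).2
    rwa [← hε'] at this
  rw [hφ, Finset.sum_filter, ← τ.symm.sum_comp, Fintype.sum_sigma, Finset.sum_eq_single i]
  · simp [hu, hε']
  · intro i' _ hi'
    simp [hi']
  · simp

/-- The classes of adapted coordinates are nonempty, since the flag is strictly decreasing. -/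
theorem PartialFlag.IsAdapted.surjective {F : PartialFlag n m} {u : GL (Fin n) ℝ}
    {w : Fin n → Fin m} (h : F.IsAdapted u w) : Function.Surjective w := by
  intro i
  by_contra! hi
  have hlt := F.strictAnti (Fin.castSucc_lt_succ (i := i))
  refine hlt.not_ge fun y hy => (h _ _).2 fun a ha => (h _ _).1 hy a ?_
  exact Fin.castSucc_lt_castSucc_iff.2 ((Fin.castSucc_lt_succ_iff.1 ha).lt_of_ne (hi a))

end AdaptedExists

/-! ### The flag of forms is determined by its group up to scaling the forms -/

section Uniqueness

variable {n m : ℕ} {w : Fin n → Fin m} {ε : Fin n → ℝ}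

/-- A choice of block sizes separating as `j → ∞`. -/
noncomputable def geomScale (m : ℕ) (j : ℕ) (i : Fin m) : ℝ := (1 / ((j : ℝ) + 1)) ^ (i : ℕ)

theorem geomScale_pos (j : ℕ) (i : Fin m) : 0 < geomScale m j i := by
  unfold geomScale
  positivity

theorem tendsto_geomScale (i i' : Fin m) (h : i < i') :
    Tendsto (fun j => geomScale m j i' / geomScale m j i) atTop (𝓝 0) := by
  have h1 : Tendsto (fun j : ℕ => (1 / ((j : ℝ) + 1)) ^ ((i' : ℕ) - i)) atTop (𝓝 0) := by
    have := (tendsto_one_div_add_atTop_nhds_zero_nat (𝕜 := ℝ)).pow ((i' : ℕ) - i)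
    rwa [zero_pow (Nat.sub_ne_zero_of_lt h)] at this
  refine h1.congr fun j => ?_
  rw [geomScale, geomScale, pow_sub₀ _ (by positivity) h.le]
  exact (div_eq_mul_inv _ _).symm

theorem mem_limitSet_geomScale_iff (hε : ∀ a, ε a ≠ 0) {l : Filter ℕ} [l.NeBot] (hl : l ≤ atTop)
    {g : GL (Fin n) ℝ} :
    g ∈ limitSet l (fun j => (isometries (scaledForm w ε (geomScale m j)) :
      Set (GL (Fin n) ℝ))) ↔ IsBlockIsometry w ε (g : Matrix (Fin n) (Fin n) ℝ) :=
  mem_limitSet_scaledForm_iff hε geomScale_pos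
    (fun i i' h => (tendsto_geomScale i i' h).mono_left hl)

theorem isBlockIsometry_of_forall_mem_isometries (hε : ∀ a, ε a ≠ 0) {g : GL (Fin n) ℝ}
    (hg : ∀ s : Fin m → ℝ, g ∈ isometries (scaledForm w ε s)) :
    IsBlockIsometry w ε (g : Matrix (Fin n) (Fin n) ℝ) :=
  (mem_limitSet_geomScale_iff hε le_rfl).1
    ⟨fun _ => g, Eventually.of_forall fun _ => hg _, tendsto_const_nhds⟩

theorem isBlockIsometry_transvection (hε : ∀ a, ε a ≠ 0) {a b : Fin n} (hab : a ≠ b)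
    (hw : w a < w b) (t : ℝ) :
    IsBlockIsometry w ε (planeGL a b hab 1 0 t (by simp) : Matrix (Fin n) (Fin n) ℝ) :=
  (mem_limitSet_geomScale_iff hε le_rfl).1
    (transvection_mem_limitSet hε geomScale_pos tendsto_geomScale hab hw t)

/-- The change of sign of the coordinate `a`. -/
def flipGL (a : Fin n) : GL (Fin n) ℝ where
  val := diagonal (Function.update 1 a (-1))
  inv := diagonal (Function.update 1 a (-1))
  val_inv := by
    rw [diagonal_mul_diagonal, ← diagonal_one]
    congr 1
    ext b
    by_cases h : b = a <;> simp [h]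
  inv_val := by
    rw [diagonal_mul_diagonal, ← diagonal_one]
    congr 1
    ext b
    by_cases h : b = a <;> simp [h]

theorem flipGL_mulVec (a : Fin n) (x : Fin n → ℝ) (b : Fin n) :
    ((flipGL a : Matrix (Fin n) (Fin n) ℝ) *ᵥ x) b = if b = a then -x b else x b := by
  change (diagonal (Function.update 1 a (-1)) *ᵥ x) b = _
  rw [mulVec_diagonal, Function.update_apply]
  split_ifs <;> simp

theorem isBlockIsometry_flipGL (hε : ∀ a, ε a ≠ 0) (a : Fin n) :
    IsBlockIsometry w ε (flipGL a : Matrix (Fin n) (Fin n) ℝ) := by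
  refine isBlockIsometry_of_forall_mem_isometries hε fun s => mem_isometries_diagonal.2 fun x =>
    Finset.sum_congr rfl fun b _ => ?_
  rw [flipGL_mulVec]
  split_ifs <;> ring

/-- In the plane of two coordinates of the same class there is a rotation or boost which mixes the
coordinates. -/
theorem exists_isBlockIsometry_mix (hε : ∀ a, ε a = -1 ∨ ε a = 1) {a b : Fin n} (hab : a ≠ b)
    (hw : w a = w b) :
    ∃ (c t : ℝ) (h : GL (Fin n) ℝ), IsBlockIsometry w ε (h : Matrix (Fin n) (Fin n) ℝ) ∧ t ≠ 0 ∧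
      c ^ 2 + ε b * ε a * t ^ 2 = 1 ∧
      (h : Matrix (Fin n) (Fin n) ℝ) *ᵥ Pi.single a 1 = c • Pi.single a 1 + t • Pi.single b 1 := by
  have hε0 : ∀ a, ε a ≠ 0 := fun a => by rcases hε a with h | h <;> rw [h] <;> norm_num
  have hsq : ε a * ε a = 1 := by rcases hε a with h | h <;> rw [h] <;> norm_num
  obtain ⟨c, t, ht, hct⟩ : ∃ c t : ℝ, t ≠ 0 ∧ c ^ 2 + ε b * ε a * t ^ 2 = 1 := by
    rcases hε a with h1 | h1 <;> rcases hε b with h2 | h2 <;> rw [h1, h2]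
    · exact ⟨3 / 5, 4 / 5, by norm_num, by norm_num⟩
    · exact ⟨5 / 3, 4 / 3, by norm_num, by norm_num⟩
    · exact ⟨5 / 3, 4 / 3, by norm_num, by norm_num⟩
    · exact ⟨3 / 5, 4 / 5, by norm_num, by norm_num⟩
  have hdet : c * c - -(ε b * ε a * t) * t = 1 := by rw [← hct]; ring
  refine ⟨c, t, planeGL a b hab c (-(ε b * ε a * t)) t hdet, ?_, ht, hct, ?_⟩
  · refine isBlockIsometry_of_forall_mem_isometries hε0 fun s =>
      planeGL_mem_isometries hab ?_ hdet
    rw [hw]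
    linear_combination ε b * s (w b) * hsq
  · rw [coe_planeGL, planeMatrix_mulVec hab]
    ext i
    by_cases h1 : i = a
    · subst h1; simp [hab]
    · by_cases h2 : i = b
      · subst h2; simp [h1]
      · simp [h1, h2]

/-- The subspaces invariant under the block triangular isometries are the coordinate subspaces
spanned by the classes from some class on: sign changes make an invariant subspace a coordinate
subspace, and transvections and rotations or boosts make its set of coordinates closed upwards. -/
theorem invariant_subspace_of_isBlockIsometry (hε : ∀ a, ε a = -1 ∨ ε a = 1)
    (W : Submodule ℝ (Fin n → ℝ)) (hW : ∀ h : GL (Fin n) ℝ,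
      IsBlockIsometry w ε (h : Matrix (Fin n) (Fin n) ℝ) →
        ∀ x ∈ W, (h : Matrix (Fin n) (Fin n) ℝ) *ᵥ x ∈ W) :
    ∃ i : Fin (m + 1), ∀ x, x ∈ W ↔ ∀ a, (w a).castSucc < i → x a = 0 := by
  classical
  have hε0 : ∀ a, ε a ≠ 0 := fun a => by rcases hε a with h | h <;> rw [h] <;> norm_num
  have hcoord : ∀ x ∈ W, ∀ a, x a ≠ 0 → (Pi.single a 1 : Fin n → ℝ) ∈ W := by
    intro x hx a ha
    have h1 : x - (flipGL a : Matrix (Fin n) (Fin n) ℝ) *ᵥ x = (2 * x a) • Pi.single a 1 := by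
      ext b
      rw [Pi.sub_apply, flipGL_mulVec]
      by_cases hb : b = a
      · subst hb; simp; ring
      · simp [hb]
    have h2 := W.sub_mem hx (hW _ (isBlockIsometry_flipGL hε0 a) x hx)
    rw [h1] at h2
    exact (W.smul_mem_iff (mul_ne_zero two_ne_zero ha)).1 h2
  have hup : ∀ a b, (Pi.single a 1 : Fin n → ℝ) ∈ W → w a ≤ w b →
      (Pi.single b 1 : Fin n → ℝ) ∈ W := by
    intro a b ha hwab
    by_cases hab : a = b
    · rwa [← hab]
    rcases hwab.lt_or_eq with hlt | heq
    · refine hcoord _ (hW _ (isBlockIsometry_transvection hε0 hab hlt 1) _ ha) b ?_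
      rw [coe_planeGL, planeMatrix_mulVec hab]
      simp [Ne.symm hab]
    · obtain ⟨c, t, h, hB, ht, -, hh⟩ := exists_isBlockIsometry_mix hε hab heq
      refine hcoord _ (hW _ hB _ ha) b ?_
      rw [hh]
      simpa [Ne.symm hab] using ht
  obtain ⟨i, hi⟩ : ∃ i : Fin (m + 1), ∀ a, (Pi.single a 1 : Fin n → ℝ) ∈ W ↔
      i ≤ (w a).castSucc := by
    set S := Finset.univ.filter fun a => (Pi.single a 1 : Fin n → ℝ) ∈ W with hS
    rcases S.eq_empty_or_nonempty with h0 | h0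
    · refine ⟨Fin.last m, fun a => ⟨fun ha => ?_, fun ha => ?_⟩⟩
      · have : a ∈ S := by simpa [hS] using ha
        simp [h0] at this
      · exact absurd ha (Fin.castSucc_lt_last _).not_ge
    · obtain ⟨a, ha, hmin⟩ := S.exists_min_image w h0
      refine ⟨(w a).castSucc, fun b => ⟨fun hb => ?_, fun hb => ?_⟩⟩
      · exact Fin.castSucc_le_castSucc_iff.2 (hmin b (by simpa [hS] using hb))
      · exact hup a b (by simpa [hS] using ha) (Fin.castSucc_le_castSucc_iff.1 hb)
  refine ⟨i, fun x => ⟨fun hx a ha => ?_, fun hx => ?_⟩⟩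
  · by_contra hne
    exact absurd ((hi a).1 (hcoord x hx a hne)) ha.not_ge
  · rw [pi_eq_sum_univ' x]
    refine W.sum_mem fun a _ => ?_
    by_cases ha : (w a).castSucc < i
    · rw [hx a ha, zero_smul]
      exact W.zero_mem
    · have h1 := (hi a).2 (not_lt.1 ha)
      refine W.smul_mem _ ?_
      convert h1 using 1

/-- The subspaces invariant under `Isom(β, F)` are exactly those of the flag. -/
theorem FlagOfForms.range_space_eq {F : PartialFlag n m} (β : FlagOfForms F) :
    Set.range F.space = {W | ∀ g ∈ β.isom,
      ∀ x ∈ W, (g : Matrix (Fin n) (Fin n) ℝ) *ᵥ x ∈ W} := by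
  obtain ⟨u, w, ε, hε, h⟩ := β.exists_isAdapted
  ext W
  constructor
  · rintro ⟨i, rfl⟩ g ⟨hg, -⟩ x hx
    exact hg.mem i x hx
  · intro hW
    obtain ⟨i, hi⟩ := invariant_subspace_of_isBlockIsometry (w := w) hε
      (W.comap (u : Matrix (Fin n) (Fin n) ℝ).mulVecLin) fun k hk x hx => by
        have h1 : u * k * u⁻¹ ∈ β.isom := by
          rw [h.mem_isom_iff]
          convert hk using 2
          group
        have h2 := hW _ h1 _ hx
        rw [Submodule.mem_comap]
        convert h2 using 1
        simp only [mulVecLin_apply, Units.val_mul, ← mulVec_mulVec, inv_mulVec_mulVec]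
    refine ⟨i, ?_⟩
    ext y
    rw [h.flag, ← hi, Submodule.mem_comap, mulVecLin_apply, mulVec_inv_mulVec]

theorem PartialFlag.eq_of_range_space_eq {m' : ℕ} {F : PartialFlag n m} {F' : PartialFlag n m'}
    (h : Set.range F.space = Set.range F'.space) : ∃ e : m' = m, F = e ▸ F' := by
  have hm : m' = m := by
    have h1 := Set.card_range_of_injective F.strictAnti.injective
    have h2 := Set.card_range_of_injective F'.strictAnti.injective
    have h3 : Fintype.card (Set.range F.space) = Fintype.card (Set.range F'.space) := by
      congr!
    rw [h1, h2, Fintype.card_fin, Fintype.card_fin] at h3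
    omega
  subst hm
  refine ⟨rfl, ?_⟩
  have h1 : F.space = F'.space := by
    have h2 : StrictMono (OrderDual.toDual ∘ F.space) := F.strictAnti.dual_right
    have h3 : StrictMono (OrderDual.toDual ∘ F'.space) := F'.strictAnti.dual_right
    exact (h2.range_inj h3).1 (by rw [Set.range_comp, Set.range_comp, h])
  cases F
  cases F'
  cases h1
  rfl

end Uniqueness

section Proportional

variable {n m : ℕ}

/-- A form on `Vᵢ / Vᵢ₊₁` which is invariant under `Isom(β, F)` is a multiple of `βᵢ`: sign changes
make it diagonal in adapted coordinates, and rotations or boosts fix the ratios of its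
coefficients. -/
theorem FlagOfForms.exists_form_eq_smul {F : PartialFlag n m} {β β' : FlagOfForms F}
    (heq : β.isom = β'.isom) (i : Fin m) :
    ∃ c : ℝ, c ≠ 0 ∧ ∀ x, β'.form i x = c * β.form i x := by
  classical
  obtain ⟨u, w, ε, hε, h⟩ := β.exists_isAdapted
  have hε0 : ∀ a, ε a ≠ 0 := fun a => by rcases hε a with h | h <;> rw [h] <;> norm_num
  have hsingle : ∀ a : {a // w a = i}, (u : Matrix (Fin n) (Fin n) ℝ) *ᵥ Pi.single a.1 1 ∈
      F.space i.castSucc := fun a => (h.flag.mulVec_mem_iff _ _).2 fun b hb =>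
    Pi.single_eq_of_ne (fun hba => by simp [hba, a.2] at hb) _
  have hinv : ∀ k : GL (Fin n) ℝ, IsBlockIsometry w ε (k : Matrix (Fin n) (Fin n) ℝ) →
      ∀ x (hx : (u : Matrix (Fin n) (Fin n) ℝ) *ᵥ x ∈ F.space i.castSucc)
      (hx' : (u : Matrix (Fin n) (Fin n) ℝ) *ᵥ ((k : Matrix (Fin n) (Fin n) ℝ) *ᵥ x) ∈
        F.space i.castSucc),
      β'.form i (Submodule.Quotient.mk ⟨_, hx'⟩) = β'.form i (Submodule.Quotient.mk ⟨_, hx⟩) := by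
    intro k hk x hx hx'
    have h1 : u * k * u⁻¹ ∈ β'.isom := by
      rw [← heq, h.mem_isom_iff]
      convert hk using 2
      group
    obtain ⟨hpres, hform⟩ := h1
    rw [← hform i (Submodule.Quotient.mk ⟨_, hx⟩)]
    congr 1
    refine congrArg Submodule.Quotient.mk (Subtype.ext ?_)
    change _ = ((u * k * u⁻¹ : GL (Fin n) ℝ) : Matrix (Fin n) (Fin n) ℝ) *ᵥ
      ((u : Matrix (Fin n) (Fin n) ℝ) *ᵥ x)
    simp only [Units.val_mul, ← mulVec_mulVec, inv_mulVec_mulVec]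
  set E := Module.Basis.ofEquivFun (h.flag.quotEquiv i) with hE
  have hEmk : ∀ a, E a = Submodule.Quotient.mk ⟨_, hsingle a⟩ := fun a => by
    apply (h.flag.quotEquiv i).injective
    rw [h.flag.quotEquiv_mk]
    ext b
    rw [PartialFlag.coordMap_apply]
    simp only [inv_mulVec_mulVec]
    simp [hE, Pi.single_apply, Subtype.ext_iff]
  -- sign changes make the basis orthogonal
  have hortho : ∀ a b, a ≠ b → QuadraticMap.polar (β'.form i) (E a) (E b) = 0 := by
    intro a b hab
    have hab' : b.1 ≠ a.1 := fun h => hab (Subtype.ext h.symm)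
    have hflip : ∀ c : ℝ, (flipGL a.1 : Matrix (Fin n) (Fin n) ℝ) *ᵥ
        (c • Pi.single a.1 1 + Pi.single b.1 1) = (-c) • Pi.single a.1 1 + Pi.single b.1 1 := by
      intro c
      ext d
      rw [flipGL_mulVec]
      by_cases hd : d = a.1
      · subst hd; simp [hab'.symm]
      · simp [hd]
    have hmk : ∀ c : ℝ, ∃ hc : (u : Matrix (Fin n) (Fin n) ℝ) *ᵥ
        (c • Pi.single a.1 1 + Pi.single b.1 1) ∈ F.space i.castSucc,
        c • E a + E b = Submodule.Quotient.mk ⟨_, hc⟩ := fun c => by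
      have hc : (u : Matrix (Fin n) (Fin n) ℝ) *ᵥ
          (c • Pi.single a.1 1 + Pi.single b.1 1) ∈ F.space i.castSucc := by
        rw [mulVec_add, mulVec_smul]
        exact add_mem (Submodule.smul_mem _ _ (hsingle a)) (hsingle b)
      refine ⟨hc, ?_⟩
      rw [hEmk, hEmk, ← Submodule.Quotient.mk_smul, ← Submodule.Quotient.mk_add]
      refine congrArg Submodule.Quotient.mk (Subtype.ext ?_)
      simp only [mulVec_add, mulVec_smul]
      rfl
    obtain ⟨h1, e1⟩ := hmk 1
    obtain ⟨h2, e2⟩ := hmk (-1)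
    have h3 := hinv _ (isBlockIsometry_flipGL hε0 a.1) _ h1 (by rw [hflip]; exact h2)
    simp only [hflip] at h3
    rw [← e1, ← e2] at h3
    have h4 : QuadraticMap.polar (β'.form i) ((-1 : ℝ) • E a) (E b) =
        -QuadraticMap.polar (β'.form i) (E a) (E b) := by
      rw [QuadraticMap.polar_smul_left]
      simp
    have h5 := h4
    rw [QuadraticMap.polar, QuadraticMap.polar, h3, QuadraticMap.map_smul, one_smul] at h5
    rw [QuadraticMap.polar]
    simp only [smul_eq_mul] at h5
    linarith
  -- rotations and boosts make the coefficients proportional to `ε`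
  have hratio : ∀ a b : {a // w a = i}, β'.form i (E b) = ε b * ε a * β'.form i (E a) := by
    intro a b
    by_cases hab : a = b
    · subst hab
      rcases hε a with h1 | h1 <;> rw [h1] <;> ring
    obtain ⟨c, t, k, hk, ht, hct, hkv⟩ := exists_isBlockIsometry_mix hε
      (fun h => hab (Subtype.ext h)) (a.2.trans b.2.symm)
    have hmem' : (u : Matrix (Fin n) (Fin n) ℝ) *ᵥ ((k : Matrix (Fin n) (Fin n) ℝ) *ᵥ
        Pi.single a.1 1) ∈ F.space i.castSucc := by
      rw [hkv, mulVec_add, mulVec_smul, mulVec_smul]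
      exact add_mem (Submodule.smul_mem _ _ (hsingle a)) (Submodule.smul_mem _ _ (hsingle b))
    have h1 := hinv k hk _ (hsingle a) hmem'
    have h2 : (Submodule.Quotient.mk ⟨_, hmem'⟩ : F.Quot i) = c • E a + t • E b := by
      rw [hEmk, hEmk, ← Submodule.Quotient.mk_smul, ← Submodule.Quotient.mk_smul,
        ← Submodule.Quotient.mk_add]
      refine congrArg Submodule.Quotient.mk (Subtype.ext ?_)
      simp only [hkv, mulVec_add, mulVec_smul]
      rfl
    have h3 : QuadraticMap.polar (β'.form i) (c • E a) (t • E b) = 0 := by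
      rw [QuadraticMap.polar_smul_left, QuadraticMap.polar_smul_right, hortho a b hab]
      simp
    rw [QuadraticMap.polar] at h3
    rw [h2, ← hEmk] at h1
    have h4 : β'.form i (c • E a + t • E b) =
        β'.form i (c • E a) + β'.form i (t • E b) := by linarith
    rw [h4, QuadraticMap.map_smul, QuadraticMap.map_smul, smul_eq_mul, smul_eq_mul] at h1
    have h5 : t ^ 2 * β'.form i (E b) = t ^ 2 * (ε b * ε a * β'.form i (E a)) := by
      linear_combination h1 - β'.form i (E a) * hct
    exact mul_left_cancel₀ (pow_ne_zero 2 ht) h5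
  obtain ⟨a₀, ha₀⟩ := h.flag.surjective i
  set c := ε a₀ * β'.form i (E ⟨a₀, ha₀⟩) with hc
  have hcE : ∀ a, β'.form i (E a) = c * ε a := fun a => by
    rw [hratio ⟨a₀, ha₀⟩ a, hc]
    ring
  have hscale : ∀ x, β'.form i x = c * β.form i x := by
    intro x
    have h1 := QuadraticMap.basisRepr_eq_of_iIsOrtho (β'.form i) E fun a b hab => by
      have := hortho a b hab
      rw [QuadraticMap.polar] at this
      change QuadraticMap.associated (β'.form i) (E a) (E b) = 0
      rw [QuadraticMap.associated_apply, this, smul_zero]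
    have h2 := DFunLike.congr_fun h1 (E.equivFun x)
    rw [QuadraticMap.basisRepr_apply, E.sum_equivFun, QuadraticMap.weightedSumSquares_apply] at h2
    rw [h2]
    induction x using Submodule.Quotient.induction_on with
    | _ y =>
    rw [h.form_mk, sum_filter_eq_sum_subtype, Finset.mul_sum]
    refine Finset.sum_congr rfl fun a _ => ?_
    have h3 : E.equivFun (Submodule.Quotient.mk y) a =
        (((u⁻¹ : GL (Fin n) ℝ) : Matrix (Fin n) (Fin n) ℝ) *ᵥ (y : Fin n → ℝ)) a := by
      rw [hE, Module.Basis.equivFun_ofEquivFun, h.flag.quotEquiv_mk, PartialFlag.coordMap_apply]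
    rw [h3, hcE, smul_eq_mul]
    ring
  refine ⟨c, fun hc0 => ?_, hscale⟩
  have hrad : E ⟨a₀, ha₀⟩ ∈ (β'.form i).radical := by
    rw [QuadraticMap.mem_radical_iff']
    simp [hscale, hc0]
  rw [(β'.nondegenerate i).radical_eq_bot, Submodule.mem_bot] at hrad
  exact E.ne_zero _ hrad

theorem FlagOfForms.signature_eq_or_eq_swap {F : PartialFlag n m} {β β' : FlagOfForms F}
    (heq : β.isom = β'.isom) (i : Fin m) :
    β.signature i = β'.signature i ∨ β.signature i = (β'.signature i).swap := by
  obtain ⟨c, hc, h⟩ := FlagOfForms.exists_form_eq_smul heq i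
  obtain ⟨u, w, ε, hε, hA⟩ := β.exists_isAdapted
  obtain ⟨e⟩ := hA.equivalent i
  have hE : (β'.form i).Equivalent
      (QuadraticMap.weightedSumSquares ℝ fun a : {a // w a = i} => c * ε a) := by
    refine ⟨{ toLinearEquiv := e.toLinearEquiv, map_app' := fun x => ?_ }⟩
    rw [h, ← e.map_app x, QuadraticMap.weightedSumSquares_apply,
      QuadraticMap.weightedSumSquares_apply, Finset.mul_sum]
    refine Finset.sum_congr rfl fun a _ => ?_
    simp only [smul_eq_mul, mul_assoc]
    rfl
  rw [signature, signature, QuadraticForm.sigNeg_of_equiv_weightedSumSquares hE,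
    QuadraticForm.sigPos_of_equiv_weightedSumSquares hE,
    QuadraticForm.sigNeg_of_equiv_weightedSumSquares ⟨e⟩,
    QuadraticForm.sigPos_of_equiv_weightedSumSquares ⟨e⟩]
  rcases lt_or_gt_of_ne hc with hc | hc
  · right
    have h1 : ∀ x, c * x < 0 ↔ 0 < x := fun x =>
      ⟨fun h => pos_of_mul_neg_right h hc.le, fun h => mul_neg_of_neg_of_pos hc h⟩
    have h2 : ∀ x, 0 < c * x ↔ x < 0 := fun x =>
      ⟨fun h => neg_of_mul_pos_right h hc.le, fun h => mul_pos_of_neg_of_neg hc h⟩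
    simp only [h1, h2, Prod.swap_prod_mk]
  · left
    have h1 : ∀ x, c * x < 0 ↔ x < 0 := fun x =>
      ⟨fun h => neg_of_mul_neg_right h hc.le, fun h => mul_neg_of_pos_of_neg hc h⟩
    simp only [h1, mul_pos_iff_of_pos_left hc]

/-- Whether the signatures of a flag of forms can be made to sum to `(p, q)` depends only on the
group `Isom(β, F)`. -/
theorem FlagOfForms.SignaturesSumTo.of_isom_eq {m' p q : ℕ} {F : PartialFlag n m}
    {F' : PartialFlag n m'} {β : FlagOfForms F} {β' : FlagOfForms F'} (heq : β.isom = β'.isom)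
    (h : β'.SignaturesSumTo p q) : β.SignaturesSumTo p q := by
  obtain ⟨e, rfl⟩ := PartialFlag.eq_of_range_space_eq (F := F) (F' := F')
    (by rw [β.range_space_eq, β'.range_space_eq, heq])
  subst e
  obtain ⟨e, he⟩ := h
  classical
  refine ⟨fun i => if β.signature i = β'.signature i then e i else !(e i), ?_⟩
  rw [← he]
  refine Finset.sum_congr rfl fun i _ => ?_
  by_cases h1 : β.signature i = β'.signature i
  · simp [h1]
  · have h2 := (FlagOfForms.signature_eq_or_eq_swap heq i).resolve_left h1
    simp only [if_neg h1]
    rw [h2]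
    cases e i <;> simp

end Proportional

/-! ### Conjugates of the indefinite orthogonal group -/

section Conjugates

variable {n m : ℕ}

/-- Replacing `βᵢ` by `-βᵢ` for the indices with `e i = true`, the signatures sum to the numbers of
negative and positive coefficients in adapted coordinates. -/
theorem FlagOfForms.IsAdapted.sum_signature {F : PartialFlag n m} {β : FlagOfForms F}
    {u : GL (Fin n) ℝ} {w : Fin n → Fin m} {ε : Fin n → ℝ} (h : β.IsAdapted u w ε)
    (e : Fin m → Bool) :
    ∑ i, (if e i then (β.signature i).swap else β.signature i) =
      ((Finset.univ.filter fun a => (if e (w a) then -ε a else ε a) < 0).card,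
        (Finset.univ.filter fun a => 0 < (if e (w a) then -ε a else ε a)).card) := by
  have key : ∀ i, (if e i then (β.signature i).swap else β.signature i) =
      ((Finset.univ.filter fun a => w a = i ∧ (if e (w a) then -ε a else ε a) < 0).card,
        (Finset.univ.filter fun a => w a = i ∧ 0 < (if e (w a) then -ε a else ε a)).card) := by
    intro i
    rw [h.signature_eq]
    cases hi : e i
    · rw [if_neg (by simp)]
      congr 3 <;> ext a <;> exact and_congr_right fun ha => by simp [ha, hi]
    · rw [if_pos rfl, Prod.swap_prod_mk]
      congr 3 <;> ext a <;> exact and_congr_right fun ha => by simp [ha, hi]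
  have hsum : ∀ (P : Fin n → Prop) [DecidablePred P],
      ∑ i, (Finset.univ.filter fun a => w a = i ∧ P a).card = (Finset.univ.filter P).card := by
    intro P _
    rw [Finset.card_eq_sum_card_fiberwise (f := w) (t := Finset.univ) (by simp [Set.MapsTo])]
    refine Finset.sum_congr rfl fun i _ => ?_
    rw [Finset.filter_filter]
    congr 1
    ext a
    simp [and_comm]
  rw [Finset.sum_congr rfl fun i _ => key i]
  refine Prod.ext ?_ ?_
  · rw [Prod.fst_sum]
    exact hsum _
  · rw [Prod.snd_sum]
    exact hsum _

/-- The coefficients `(-1, …, -1, 1, …, 1)` of the standard form of signature `(p, q)`. -/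
def stdSign (p q : ℕ) (a : Fin (p + q)) : ℝ := if (a : ℕ) < p then -1 else 1

theorem stdSign_eq_or (p q : ℕ) (a : Fin (p + q)) : stdSign p q a = -1 ∨ stdSign p q a = 1 := by
  unfold stdSign
  split_ifs <;> simp

theorem stdSign_ne_zero (p q : ℕ) (a : Fin (p + q)) : stdSign p q a ≠ 0 := by
  rcases stdSign_eq_or p q a with h | h <;> rw [h] <;> norm_num

theorem card_stdSign_neg (p q : ℕ) :
    (Finset.univ.filter fun a => stdSign p q a < 0).card = p := by
  have : (Finset.univ.filter fun a => stdSign p q a < 0) =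
      Finset.univ.map (Fin.castAddEmb q : Fin p ↪ Fin (p + q)) := by
    ext a
    induction a using Fin.addCases with
    | left a =>
      rw [Finset.mem_filter_univ, stdSign, if_pos (by simp)]
      simp
    | right a =>
      simp only [Finset.mem_filter_univ, Finset.mem_map, Finset.mem_univ, true_and]
      refine ⟨fun h => ?_, ?_⟩
      · simp [stdSign] at h
        linarith
      · rintro ⟨b, hb⟩
        have := congrArg Fin.val hb
        simp at this
        omega
  rw [this, Finset.card_map, Finset.card_univ, Fintype.card_fin]

theorem card_stdSign_pos (p q : ℕ) :
    (Finset.univ.filter fun a => 0 < stdSign p q a).card = q := by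
  have h1 := Finset.card_filter_add_card_filter_not (s := (Finset.univ : Finset (Fin (p + q))))
    (fun a => stdSign p q a < 0)
  rw [card_stdSign_neg, Finset.card_univ, Fintype.card_fin] at h1
  have h2 : (Finset.univ.filter fun a => 0 < stdSign p q a) =
      Finset.univ.filter fun a => ¬ stdSign p q a < 0 := by
    ext a
    simp only [Finset.mem_filter_univ, not_lt]
    exact ⟨le_of_lt, fun h => lt_of_le_of_ne h (stdSign_ne_zero p q a).symm⟩
  rw [h2]
  omega

theorem mem_indefiniteO_iff {p q : ℕ} {g : GL (Fin (p + q)) ℝ} :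
    g ∈ indefiniteO p q ↔ g ∈ isometries (diagonal (stdSign p q)) := by
  rw [mem_isometries_diagonal]
  refine forall_congr' fun x => ?_
  simp only [stdForm, QuadraticMap.weightedSumSquares_apply, smul_eq_mul, sq, stdSign]

theorem mem_map_conj_iff {G : Type*} [Group G] (H : Subgroup G) (c g : G) :
    g ∈ H.map (MulAut.conj c).toMonoidHom ↔ c⁻¹ * g * c ∈ H := by
  rw [Subgroup.mem_map]
  constructor
  · rintro ⟨h, hh, rfl⟩
    convert hh using 1
    simp only [MulEquiv.coe_toMonoidHom, MulAut.conj_apply]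
    group
  · intro h
    refine ⟨_, h, ?_⟩
    simp only [MulEquiv.coe_toMonoidHom, MulAut.conj_apply]
    group

theorem isClosed_map_conj {p q : ℕ} (c : GL (Fin (p + q)) ℝ) :
    IsClosed ((indefiniteO p q).map (MulAut.conj c).toMonoidHom : Set (GL (Fin (p + q)) ℝ)) := by
  have : ((indefiniteO p q).map (MulAut.conj c).toMonoidHom : Set (GL (Fin (p + q)) ℝ)) =
      (fun g => c⁻¹ * g * c) ⁻¹' (isometries (diagonal (stdSign p q)) :
        Set (GL (Fin (p + q)) ℝ)) := by
    ext g
    exact (mem_map_conj_iff _ _ _).trans mem_indefiniteO_iff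
  rw [this]
  exact (isClosed_isometries _).preimage (by fun_prop)

/-- Along an ultrafilter, any sequence of conjugates of `O(p, q)` converges to some `Isom(β, F)`
whose signatures sum to `(p, q)`. -/
theorem exists_limitSet_eq_isom (U : Ultrafilter ℕ) {p q : ℕ} (c : ℕ → GL (Fin (p + q)) ℝ) :
    ∃ (m : ℕ) (F : PartialFlag (p + q) m) (β : FlagOfForms F), β.SignaturesSumTo p q ∧
      limitSet (U : Filter ℕ) (fun j => ((indefiniteO p q).map (MulAut.conj (c j)).toMonoidHom :
        Set (GL (Fin (p + q)) ℝ))) = β.isom := by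
  obtain ⟨m, w, ε, u, hw, hε, hneg, hpos, hmem⟩ :=
    exists_isBlockIsometry_iff_mem_limitSet U (stdSign_ne_zero p q) c
  have hε0 : ∀ a, ε a ≠ 0 := fun a => by rcases hε a with h | h <;> rw [h] <;> norm_num
  obtain ⟨F, β, hβ⟩ := exists_flagOfForms_isAdapted u hw hε0
  have key : ∀ (P : Fin (p + q) → Prop) [DecidablePred P],
      {a | P a}.ncard = (Finset.univ.filter P).card := fun P _ => by
    rw [← Set.ncard_coe_finset]
    simp
  refine ⟨m, F, β, ⟨fun _ => false, ?_⟩, ?_⟩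
  · rw [hβ.sum_signature]
    simp only [key, card_stdSign_neg, card_stdSign_pos] at hneg hpos
    simp [hneg, hpos]
  · ext g
    rw [SetLike.mem_coe, hβ.mem_isom_iff, ← hmem]
    have : (fun j => ((indefiniteO p q).map (MulAut.conj (c j)).toMonoidHom :
        Set (GL (Fin (p + q)) ℝ))) =
        fun j => {g | (c j)⁻¹ * g * c j ∈ isometries (diagonal (stdSign p q))} := by
      funext j
      ext g
      exact (mem_map_conj_iff _ _ _).trans mem_indefiniteO_iff
    rw [this]

theorem IsBlockIsometry.of_signs {w : Fin n → Fin m} {ε : Fin n → ℝ} (e : Fin m → Bool)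
    {g : Matrix (Fin n) (Fin n) ℝ} (h : IsBlockIsometry w ε g) :
    IsBlockIsometry w (fun a => if e (w a) then -ε a else ε a) g := by
  refine ⟨h.1, fun a b hab => ?_⟩
  have h1 := h.block a b hab
  cases hi : e (w a)
  · simp only [Bool.false_eq_true, if_false]
    rw [← h1]
    refine Finset.sum_congr rfl fun c hc => ?_
    rw [(Finset.mem_filter.1 hc).2, hi, if_neg (by simp)]
  · have h2 : ∑ c with w c = w a, (if e (w c) then -ε c else ε c) * (g c a * g c b) =
        -∑ c with w c = w a, ε c * (g c a * g c b) := by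
      rw [← Finset.sum_neg_distrib]
      refine Finset.sum_congr rfl fun c hc => ?_
      rw [(Finset.mem_filter.1 hc).2, hi, if_pos rfl, neg_mul]
    rw [h2, h1, if_pos rfl]
    split_ifs <;> simp

theorem isBlockIsometry_signs_iff {w : Fin n → Fin m} {ε : Fin n → ℝ} (e : Fin m → Bool)
    {g : Matrix (Fin n) (Fin n) ℝ} :
    IsBlockIsometry w (fun a => if e (w a) then -ε a else ε a) g ↔ IsBlockIsometry w ε g := by
  refine ⟨fun h => ?_, fun h => h.of_signs e⟩
  convert h.of_signs e using 1
  ext a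
  split_ifs <;> simp

/-- Diagonal forms with the same numbers of positive and negative coefficients are congruent. -/
theorem exists_congruent_diagonal {ε δ : Fin n → ℝ} (hε : ∀ a, ε a = -1 ∨ ε a = 1)
    (hδ : ∀ a, δ a = -1 ∨ δ a = 1)
    (hneg : (Finset.univ.filter fun a => ε a < 0).card =
      (Finset.univ.filter fun a => δ a < 0).card)
    (hpos : (Finset.univ.filter fun a => 0 < ε a).card =
      (Finset.univ.filter fun a => 0 < δ a).card) {s : Fin n → ℝ} (hs : ∀ a, 0 < s a) :
    ∃ Y : GL (Fin n) ℝ, (Y : Matrix (Fin n) (Fin n) ℝ)ᵀ * diagonal (fun a => ε a * s a) * Y =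
      diagonal δ := by
  have hcard : ∀ y : ℝ, Nonempty ({a // ε a = y} ≃ {a // δ a = y}) := by
    intro y
    refine Fintype.card_eq.1 ?_
    rw [Fintype.card_subtype, Fintype.card_subtype]
    by_cases h1 : y = -1
    · have : ∀ f : Fin n → ℝ, (∀ a, f a = -1 ∨ f a = 1) → ∀ a, f a = y ↔ f a < 0 := by
        intro f hf a
        rcases hf a with h | h <;> rw [h, h1] <;> norm_num
      simp only [this ε hε, this δ hδ, hneg]
    · by_cases h2 : y = 1
      · have : ∀ f : Fin n → ℝ, (∀ a, f a = -1 ∨ f a = 1) → ∀ a, f a = y ↔ 0 < f a := by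
          intro f hf a
          rcases hf a with h | h <;> rw [h, h2] <;> norm_num
        simp only [this ε hε, this δ hδ, hpos]
      · have : ∀ f : Fin n → ℝ, (∀ a, f a = -1 ∨ f a = 1) → ∀ a, f a = y ↔ False := by
          intro f hf a
          refine iff_false_intro fun h => ?_
          rcases hf a with h' | h'
          exacts [h1 (h.symm.trans h'), h2 (h.symm.trans h')]
        simp only [this ε hε, this δ hδ]
  let σ : Fin n ≃ Fin n := Equiv.ofFiberEquiv fun y => (hcard y).some
  have hσ : ∀ a, δ (σ a) = ε a := fun a => Equiv.ofFiberEquiv_map _ a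
  set Y : Matrix (Fin n) (Fin n) ℝ :=
    (diagonal fun a => (√(s a))⁻¹).submatrix id σ.symm with hY
  have hform : Yᵀ * diagonal (fun a => ε a * s a) * Y = diagonal δ := by
    have h1 : Yᵀ * diagonal (fun a => ε a * s a) * Y =
        ((diagonal fun a => (√(s a))⁻¹) * diagonal (fun a => ε a * s a) *
          (diagonal fun a => (√(s a))⁻¹)).submatrix σ.symm σ.symm := by
      rw [hY, transpose_submatrix, diagonal_transpose]
      ext a b
      simp only [diagonal_mul_diagonal, submatrix_apply, mul_apply, diagonal_apply, id,
        EmbeddingLike.apply_eq_iff_eq, ite_mul, mul_ite, zero_mul, mul_zero,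
        Finset.sum_ite_eq', Finset.mem_univ, if_true]
      split_ifs with hab
      · rw [hab]
      · rfl
    rw [h1, diagonal_mul_diagonal, diagonal_mul_diagonal, submatrix_diagonal_equiv]
    congr 1
    ext a
    have h2 := Real.mul_self_sqrt (hs (σ.symm a)).le
    have h3 := (hs (σ.symm a)).ne'
    have h4 := hσ (σ.symm a)
    rw [Equiv.apply_symm_apply] at h4
    calc _ = ε (σ.symm a) * s (σ.symm a) * (√(s (σ.symm a)) * √(s (σ.symm a)))⁻¹ := by
          rw [mul_inv, Function.comp_apply]
          ring
      _ = δ a := by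
          rw [h2, h4]
          field_simp
  have hdet : Y.det ≠ 0 := by
    intro h0
    have := congrArg Matrix.det hform
    rw [det_mul, h0, mul_zero, det_diagonal] at this
    refine Finset.prod_ne_zero_iff.2 (fun a _ => ?_) this.symm
    rcases hδ a with h | h <;> rw [h] <;> norm_num
  exact ⟨GeneralLinearGroup.mkOfDetNeZero Y hdet, hform⟩

/-- If the signatures sum to `(p, q)`, then `Isom(β, F)` is the limit of the conjugates of `O(p, q)`
which, in adapted coordinates, are the isometry groups of diagonal forms with separating blocks. -/
theorem FlagOfForms.SignaturesSumTo.exists_limitSet_eq {p q : ℕ} {F : PartialFlag (p + q) m}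
    {β : FlagOfForms F} (h : β.SignaturesSumTo p q) :
    ∃ c : ℕ → GL (Fin (p + q)) ℝ, ∀ (l : Filter ℕ) [l.NeBot], l ≤ atTop →
      limitSet l (fun j => ((indefiniteO p q).map (MulAut.conj (c j)).toMonoidHom :
        Set (GL (Fin (p + q)) ℝ))) = β.isom := by
  obtain ⟨e, he⟩ := h
  obtain ⟨u, w, ε, hε, hA⟩ := β.exists_isAdapted
  rw [hA.sum_signature, Prod.mk.injEq] at he
  set ε' : Fin (p + q) → ℝ := fun a => if e (w a) then -ε a else ε a with hε'
  have hε1 : ∀ a, ε' a = -1 ∨ ε' a = 1 := fun a => by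
    rcases hε a with h | h <;> simp only [hε', h] <;> split_ifs <;> simp
  have hε0 : ∀ a, ε' a ≠ 0 := fun a => by rcases hε1 a with h | h <;> rw [h] <;> norm_num
  choose Y hY using fun j => exists_congruent_diagonal hε1 (stdSign_eq_or p q)
    (he.1.trans (card_stdSign_neg p q).symm) (he.2.trans (card_stdSign_pos p q).symm)
    (s := fun a => geomScale m j (w a)) (fun a => geomScale_pos j (w a))
  refine ⟨fun j => u * Y j, fun l _ hl => ?_⟩
  ext g
  rw [SetLike.mem_coe, hA.mem_isom_iff, ← isBlockIsometry_signs_iff e,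
    ← mem_limitSet_geomScale_iff hε0 hl]
  refine mem_limitSet_conj_const u (fun j g => ?_) g
  rw [SetLike.mem_coe, mem_map_conj_iff, mem_indefiniteO_iff, SetLike.mem_coe]
  refine Iff.trans ?_ (mem_isometries_conj (hY j) _).symm
  dsimp only
  have : (u * Y j)⁻¹ * g * (u * Y j) = (Y j)⁻¹ * (u⁻¹ * g * u) * Y j := by group
  rw [this]

/-! ### Properties of the limits used in the projective group -/

theorem abs_det_of_mem_isometries {d : Fin n → ℝ} (hd : ∀ a, d a ≠ 0) {g : GL (Fin n) ℝ}
    (hg : g ∈ isometries (diagonal d)) : |(g : Matrix (Fin n) (Fin n) ℝ).det| = 1 := by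
  have h1 := congrArg Matrix.det (mem_isometries.1 hg)
  rw [det_mul, det_mul, det_transpose] at h1
  have h2 : (diagonal d).det ≠ 0 := by
    rw [det_diagonal]
    exact Finset.prod_ne_zero_iff.2 fun a _ => hd a
  have h3 : (g : Matrix (Fin n) (Fin n) ℝ).det * (g : Matrix (Fin n) (Fin n) ℝ).det = 1 :=
    mul_right_cancel₀ h2 (by linear_combination h1)
  rcases mul_self_eq_one_iff.1 h3 with h | h <;> simp [h]

theorem abs_det_of_mem_limitSet {l : Filter ℕ} [l.NeBot] {H : ℕ → Set (GL (Fin n) ℝ)}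
    (hH : ∀ j, ∀ h ∈ H j, |(h : Matrix (Fin n) (Fin n) ℝ).det| = 1) {g : GL (Fin n) ℝ}
    (hg : g ∈ limitSet l H) : |(g : Matrix (Fin n) (Fin n) ℝ).det| = 1 := by
  obtain ⟨h, hh, hlim⟩ := hg
  have hcont : Continuous fun g : GL (Fin n) ℝ => |(g : Matrix (Fin n) (Fin n) ℝ).det| :=
    Units.continuous_val.matrix_det.abs
  refine tendsto_nhds_unique ((hcont.tendsto g).comp hlim) (tendsto_const_nhds.congr' ?_)
  filter_upwards [hh] with j hj
  exact (hH j _ hj).symm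

theorem FlagOfForms.abs_det_of_mem_isom {F : PartialFlag n m} {β : FlagOfForms F}
    {g : GL (Fin n) ℝ} (hg : g ∈ β.isom) : |(g : Matrix (Fin n) (Fin n) ℝ).det| = 1 := by
  obtain ⟨u, w, ε, hε, hA⟩ := β.exists_isAdapted
  have hε0 : ∀ a, ε a ≠ 0 := fun a => by rcases hε a with h | h <;> rw [h] <;> norm_num
  have h1 := abs_det_of_mem_limitSet (fun j h hh => abs_det_of_mem_isometries
      (fun a => mul_ne_zero (hε0 a) (geomScale_pos j (w a)).ne') hh)
    ((mem_limitSet_geomScale_iff hε0 le_rfl).2 ((hA.mem_isom_iff g).1 hg))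
  rw [Units.val_mul, Units.val_mul, Matrix.mul_assoc, det_mul_comm, Matrix.mul_assoc,
    Units.mul_inv, Matrix.mul_one] at h1
  exact h1

theorem FlagOfForms.neg_mem_isom {F : PartialFlag n m} {β : FlagOfForms F}
    {g : GL (Fin n) ℝ} (hg : g ∈ β.isom) : -g ∈ β.isom := by
  obtain ⟨u, w, ε, -, hA⟩ := β.exists_isAdapted
  rw [hA.mem_isom_iff] at hg ⊢
  rw [mul_neg, neg_mul, Units.val_neg]
  exact ⟨hg.1.neg, fun a b hab => by simpa using hg.2 a b hab⟩

theorem FlagOfForms.isClosed_isom {F : PartialFlag n m} (β : FlagOfForms F) :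
    IsClosed (β.isom : Set (GL (Fin n) ℝ)) := by
  obtain ⟨u, w, ε, -, hA⟩ := β.exists_isAdapted
  have : (β.isom : Set (GL (Fin n) ℝ)) = (fun g => u⁻¹ * g * u) ⁻¹'
      {g : GL (Fin n) ℝ | IsBlockIsometry w ε (g : Matrix (Fin n) (Fin n) ℝ)} := by
    ext g
    exact hA.mem_isom_iff g
  rw [this]
  exact isClosed_isBlockIsometry.preimage (by fun_prop)

theorem abs_det_of_mem_map_conj {p q : ℕ} {c g : GL (Fin (p + q)) ℝ}
    (hg : g ∈ (indefiniteO p q).map (MulAut.conj c).toMonoidHom) :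
    |(g : Matrix (Fin (p + q)) (Fin (p + q)) ℝ).det| = 1 := by
  rw [mem_map_conj_iff, mem_indefiniteO_iff] at hg
  have h1 := abs_det_of_mem_isometries (stdSign_ne_zero p q) hg
  rw [Units.val_mul, Units.val_mul, Matrix.mul_assoc, det_mul_comm, Matrix.mul_assoc,
    Units.mul_inv, Matrix.mul_one] at h1
  exact h1

theorem neg_mem_map_conj {p q : ℕ} {c g : GL (Fin (p + q)) ℝ}
    (hg : g ∈ (indefiniteO p q).map (MulAut.conj c).toMonoidHom) :
    -g ∈ (indefiniteO p q).map (MulAut.conj c).toMonoidHom := by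
  rw [mem_map_conj_iff, mem_indefiniteO_iff, mem_isometries] at hg ⊢
  rw [mul_neg, neg_mul, Units.val_neg, transpose_neg]
  simpa using hg

theorem coe_map_conj_proj (H : Subgroup (GL (Fin n) ℝ)) (c : GL (Fin n) ℝ) :
    ((proj H).map (MulAut.conj (ProjGenLinGroup.mk c)).toMonoidHom : Set PGL(n, ℝ)) =
      ProjGenLinGroup.mk '' (H.map (MulAut.conj c).toMonoidHom : Set (GL (Fin n) ℝ)) := by
  simp only [proj, Subgroup.coe_map, Set.image_image]
  refine Set.image_congr fun g _ => ?_
  simp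

/-- `Isom(β, F)` is determined by its image in the projective group. -/
theorem FlagOfForms.isom_le_of_proj_eq {m' : ℕ} {F : PartialFlag n m} {F' : PartialFlag n m'}
    {β : FlagOfForms F} {β' : FlagOfForms F'} (h : proj β.isom = proj β'.isom) :
    β.isom ≤ β'.isom := by
  intro g hg
  obtain ⟨k, hk, hkg⟩ : ProjGenLinGroup.mk g ∈ proj β'.isom :=
    h ▸ Subgroup.mem_map_of_mem _ hg
  have h2 : normalize g ∈ β'.isom := normalize_mem_of_mk_mem
    (H := (β'.isom : Set (GL (Fin n) ℝ))) (fun _ => abs_det_of_mem_isom)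
    (fun _ => neg_mem_isom) ⟨k, hk, hkg⟩
  have h3 : normalize g = g ∨ normalize g = -g := by
    simpa using normalize_mul_scalar (abs_det_of_mem_isom hg) 1
  rcases h3 with h3 | h3 <;> rw [h3] at h2
  · exact h2
  · simpa using neg_mem_isom h2

end Conjugates

/-! ### Classification of the conjugacy limits -/

theorem IsConjugacyLimit.exists_eq_isom {p q : ℕ} {L : Subgroup (GL (Fin (p + q)) ℝ)}
    (h : IsConjugacyLimit (indefiniteO p q) L) :
    ∃ (m : ℕ) (F : PartialFlag (p + q) m) (β : FlagOfForms F),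
      β.SignaturesSumTo p q ∧ L = β.isom := by
  obtain ⟨c, hc⟩ := h
  obtain ⟨m, F, β, hβ, hlim⟩ := exists_limitSet_eq_isom (hyperfilter ℕ) c
  have h1 := hc.limitSet_eq (hyperfilter ℕ) Nat.hyperfilter_le_atTop
  exact ⟨m, F, β, hβ, SetLike.coe_injective (h1.symm.trans hlim)⟩

theorem IsConjugacyLimit.exists_eq_proj_isom {p q : ℕ} {L : Subgroup PGL(p + q, ℝ)}
    (h : IsConjugacyLimit (proj (indefiniteO p q)) L) :
    ∃ (m : ℕ) (F : PartialFlag (p + q) m) (β : FlagOfForms F),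
      β.SignaturesSumTo p q ∧ L = proj β.isom := by
  obtain ⟨c, hc⟩ := h
  choose c' hc' using fun j => ProjGenLinGroup.mk_surjective (c j)
  obtain rfl : (fun j => ProjGenLinGroup.mk (c' j)) = c := funext hc'
  obtain ⟨m, F, β, hβ, hlim⟩ := exists_limitSet_eq_isom (hyperfilter ℕ) c'
  have h1 := hc.limitSet_eq (hyperfilter ℕ) Nat.hyperfilter_le_atTop
  simp only [coe_map_conj_proj] at h1
  refine ⟨m, F, β, hβ, SetLike.coe_injective (h1.symm.trans ?_)⟩
  have h2 : (proj β.isom : Set PGL(p + q, ℝ)) = ProjGenLinGroup.mk '' (β.isom : Set _) := rfl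
  rw [h2, ← hlim]
  exact (limitSet_image_mk_subset _ (fun j h hh => abs_det_of_mem_map_conj hh)
    fun j h hh => neg_mem_map_conj hh).antisymm (image_mk_limitSet_subset _ _)

theorem FlagOfForms.SignaturesSumTo.isConjugacyLimit {p q m : ℕ} {F : PartialFlag (p + q) m}
    {β : FlagOfForms F} (h : β.SignaturesSumTo p q) :
    IsConjugacyLimit (indefiniteO p q) β.isom := by
  obtain ⟨c, hc⟩ := h.exists_limitSet_eq
  exact ⟨c, convergesGeometrically_of_limitSet (fun j => isClosed_map_conj (c j)) β.isClosed_isom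
    (hc atTop le_rfl).ge fun U hU => (hc U hU).le⟩

theorem FlagOfForms.SignaturesSumTo.isConjugacyLimit_proj {p q m : ℕ} {F : PartialFlag (p + q) m}
    {β : FlagOfForms F} (h : β.SignaturesSumTo p q) :
    IsConjugacyLimit (proj (indefiniteO p q)) (proj β.isom) := by
  obtain ⟨c, hc⟩ := h.exists_limitSet_eq
  refine ⟨fun j => ProjGenLinGroup.mk (c j), convergesGeometrically_of_limitSet (fun j => ?_)
    (isClosed_image_mk β.isClosed_isom (fun _ => abs_det_of_mem_isom) fun _ => neg_mem_isom)
    ?_ fun U hU => ?_⟩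
  · rw [coe_map_conj_proj]
    exact isClosed_image_mk (isClosed_map_conj _) (fun h hh => abs_det_of_mem_map_conj hh)
      fun h hh => neg_mem_map_conj hh
  · simp only [coe_map_conj_proj]
    refine subset_trans ?_ (image_mk_limitSet_subset _ _)
    rw [hc atTop le_rfl]
    exact subset_rfl
  · simp only [coe_map_conj_proj]
    refine (limitSet_image_mk_subset U (fun j h hh => abs_det_of_mem_map_conj hh)
      fun j h hh => neg_mem_map_conj hh).trans ?_
    rw [hc U hU]
    exact subset_rfl

end GeometricLimits

theorem mainTheorem5 (p q : ℕ) :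
    -- limits of `O(p,q)` in `GL(p+q, ℝ)`
    ((∀ L : Subgroup (GL (Fin (p + q)) ℝ),
        GeometricLimits.IsConjugacyLimit (GeometricLimits.indefiniteO p q) L →
        ∃ (m : ℕ) (F : GeometricLimits.PartialFlag (p + q) m)
          (β : GeometricLimits.FlagOfForms F), L = β.isom) ∧
      (∀ (m : ℕ) (F : GeometricLimits.PartialFlag (p + q) m) (β : GeometricLimits.FlagOfForms F),
        GeometricLimits.IsConjugacyLimit (GeometricLimits.indefiniteO p q) β.isom ↔
          β.SignaturesSumTo p q)) ∧
    -- limits of `PO(p,q)` in `PGL(p+q, ℝ)`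
    ((∀ L : Subgroup PGL(p + q, ℝ),
        GeometricLimits.IsConjugacyLimit
          (GeometricLimits.proj (GeometricLimits.indefiniteO p q)) L →
        ∃ (m : ℕ) (F : GeometricLimits.PartialFlag (p + q) m)
          (β : GeometricLimits.FlagOfForms F), L = GeometricLimits.proj β.isom) ∧
      (∀ (m : ℕ) (F : GeometricLimits.PartialFlag (p + q) m) (β : GeometricLimits.FlagOfForms F),
        GeometricLimits.IsConjugacyLimit
            (GeometricLimits.proj (GeometricLimits.indefiniteO p q))
            (GeometricLimits.proj β.isom) ↔
          β.SignaturesSumTo p q)) := by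
  refine ⟨⟨fun L hL => ?_, fun m F β => ⟨fun hL => ?_, fun h => h.isConjugacyLimit⟩⟩,
    ⟨fun L hL => ?_, fun m F β => ⟨fun hL => ?_, fun h => h.isConjugacyLimit_proj⟩⟩⟩
  · obtain ⟨m, F, β, -, h⟩ := hL.exists_eq_isom
    exact ⟨m, F, β, h⟩
  · obtain ⟨m', F', β', hβ', h⟩ := hL.exists_eq_isom
    exact hβ'.of_isom_eq h
  · obtain ⟨m, F, β, -, h⟩ := hL.exists_eq_proj_isom
    exact ⟨m, F, β, h⟩
  · obtain ⟨m', F', β', hβ', h⟩ := hL.exists_eq_proj_isom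
    exact hβ'.of_isom_eq ((GeometricLimits.FlagOfForms.isom_le_of_proj_eq h).antisymm
      (GeometricLimits.FlagOfForms.isom_le_of_proj_eq h.symm))
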